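/- \textbf{Setting.} Let $\kappa\in\mathbb N$, let $\chi$ be a probability distribution on $\mathbb N_0$ with $\chi(0)<1$ and generating function $G(x)=\sum_{m\ge 0}x^m\chi(m)$, $x \in [0,1]$, and let $p_{-1},p_0,p_1$ be nonnegative with $p_{-1}+p_0+p_1=1$. Let $T$ be the rooted Galton--Watson tree with root $\phi$ and offspring distribution $\chi$, whose edges carry independent weights (independent also of the tree) equal to $k$ with probability $p_k$, $k\in\{-1,0,1\}$. For $i,j\in\{0,\dots,\kappa\}$ with $(i,j)\notin\{(0,0),(\kappa,\kappa)\}$, the game $\mathcal G(i,j,\kappa,T)[\phi]$ is the following two-player game of perfect information. A token starts at $\phi$; the players $P_1$ and $P_2$ have initial capitals $i$ and $j$ and move alternately, $P_1$ first. A move takes the token from its current vertex to a child of that vertex, and the mover receives the weight of the edge traversed (which is added to her capital). The game ends as soon as a player's capital is $\kappa$ (she wins) or $0$ (she loses), or, the capitals not having decided the game, when the token is at a leaf (the player who has to move loses); this includes the situation before the first move. A player wins the game if she has a strategy that wins, in finitely many moves, against every strategy of the opponent; if neither player has one, the game is a draw. Let $w_{i,j}$, $\ell_{i,j}$, $d_{i,j}$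 be the probabilities that $P_1$ wins $\mathcal G(i,j,\kappa,T)[\phi]$, that $P_1$ loses it, and that it is a draw. Let $\mathcal T_{i,j}$ be the duration of the game: the number of moves when the winner plays a winning strategy so as to finish as quickly as possible and the loser prolongs the game as much as possible, and $\infty$ if the game is a draw. \textbf{Theorem.} Assume that $p_{-1},p_0,p_1$ are all strictly positive. For $i,j\in\{1,\dots,\kappa-1\}$ put $$\alpha_{i,j}=p_{-1}w_{j,i-1}+p_0w_{j,i}+p_1w_{j,i+1},\qquad \beta_{i,j}=p_{-1}(1-\ell_{j,i-1})+p_0(1-\ell_{j,i})+p_1(1-\ell_{j,i+1}),$$ and, for $s,t\in\{1,\dots,\kappa-1\}$, $$C^{(i,j)}_{(s,t)}=\begin{cases}G'(\beta_{s,t})\,G'(\alpha_{t,i})\,p_{i-s}\,p_{j-t}&\text{if } s\in\{i-1,i,i+1\}\text{ and } t\in\{j-1,j,j+1\},\\0&\text{otherwise.}\end{cases}$$ If $d_{i',j'}=0$ for all $i',j'\in\{1,\dots,\kappa-1\}$ and $$\sum_{s,t\in\{1,\dots,\kappa-1\}}C^{(i',j')}_{(s,t)}<1\quad\text{for all } i',j'\in\{1,\dots,\kappa-1\},$$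 then $\mathbb E[\mathcal T_{i,j}]<\infty$ for all $i,j\in\{1,\dots,\kappa-1\}$. -/

import Mathlib

open MeasureTheory
open scoped ENNReal

namespace WeightedTreeGame

/-! ### Rooted edge-weighted trees -/

/-- A rooted, locally finite, edge-weighted tree in Ulam-Harris coding. A vertex is the list of the
child indices on the path from the root `[]` to it, and the children of `v` are the vertices
`v ++ [c]` with `c < numChildren v`. The label of `v` consists of the number of children of `v` and
of the weight of the edge from the parent of `v` to `v`. The weight stored at the root, and the
labels of lists that are not vertices, play no role. -/
abbrev WTree : Type := List ℕ → ℕ × ℤ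

/-- The number of children of a vertex. -/
def numChildren (t : WTree) (v : List ℕ) : ℕ := (t v).1

/-- The weight of the edge from the parent of `v` to `v`. -/
def weight (t : WTree) (v : List ℕ) : ℤ := (t v).2

/-! ### The game on a deterministic tree -/

/-- A strategy chooses a child at every vertex that has a child. In a tree the current vertex
determines the whole history of the play, so a strategy may depend on the history. -/
def Strategy (t : WTree) : Type :=
  {σ : List ℕ → ℕ // ∀ v, 0 < numChildren t v → σ v < numChildren t v}

/-- The location of the token and the current capitals of the first and the second player. -/
structure Position where
  vertex : List ℕ
  capital₁ : ℤ
  capital₂ : ℤ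

/-- The position after `n` moves when the token starts at `v`, the initial capitals are `i` and `j`,
the first player (who moves first) uses `σ` and the second player uses `τ`. Whoever moves the token
along an edge receives the weight of this edge. Only the positions up to the end of the game
matter. -/
def play (t : WTree) (v : List ℕ) (i j : ℤ) (σ τ : Strategy t) : ℕ → Position
  | 0 => ⟨v, i, j⟩
  | n + 1 =>
    let q := play t v i j σ τ n
    if Even n then
      let u := q.vertex ++ [σ.1 q.vertex]
      ⟨u, q.capital₁ + weight t u, q.capital₂⟩
    else
      let u := q.vertex ++ [τ.1 q.vertex]
      ⟨u, q.capital₁, q.capital₂ + weight t u⟩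

/-- The position `q`, reached after `n` moves, is a win for the first player: her capital is `κ`, or
the capital of her opponent is `0`, or (the capitals not having decided the game) it is the
opponent who has to move, from a leaf. -/
def Won₁ (κ : ℕ) (t : WTree) (n : ℕ) (q : Position) : Prop :=
  q.capital₁ = κ ∨ q.capital₂ = 0 ∨
    (q.capital₁ ≠ 0 ∧ q.capital₂ ≠ κ ∧ numChildren t q.vertex = 0 ∧ Odd n)

/-- The position `q`, reached after `n` moves, is a win for the second player. -/
def Won₂ (κ : ℕ) (t : WTree) (n : ℕ) (q : Position) : Prop :=
  q.capital₂ = κ ∨ q.capital₁ = 0 ∨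
    (q.capital₂ ≠ 0 ∧ q.capital₁ ≠ κ ∧ numChildren t q.vertex = 0 ∧ Even n)

/-- The game is decided in the position `q`, reached after `n` moves. -/
def Over (κ : ℕ) (t : WTree) (n : ℕ) (q : Position) : Prop :=
  Won₁ κ t n q ∨ Won₂ κ t n q

/-- The play of `σ` against `τ` ends, and the first player wins it. -/
def WinsPlay₁ (κ : ℕ) (t : WTree) (v : List ℕ) (i j : ℤ) (σ τ : Strategy t) : Prop :=
  ∃ n, Won₁ κ t n (play t v i j σ τ n) ∧ ∀ m < n, ¬ Over κ t m (play t v i j σ τ m)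

/-- The play of `σ` against `τ` ends, and the second player wins it. -/
def WinsPlay₂ (κ : ℕ) (t : WTree) (v : List ℕ) (i j : ℤ) (σ τ : Strategy t) : Prop :=
  ∃ n, Won₂ κ t n (play t v i j σ τ n) ∧ ∀ m < n, ¬ Over κ t m (play t v i j σ τ m)

/-- The number of moves in the play of `σ` against `τ` (`⊤` if the play never ends). -/
noncomputable def playDuration (κ : ℕ) (t : WTree) (v : List ℕ) (i j : ℤ)
    (σ τ : Strategy t) : ℕ∞ :=
  ⨅ (n : ℕ) (_ : Over κ t n (play t v i j σ τ n)), (n : ℕ∞)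

/-- `σ` is a winning strategy of the first player. -/
def Winning₁ (κ : ℕ) (t : WTree) (v : List ℕ) (i j : ℤ) (σ : Strategy t) : Prop :=
  ∀ τ, WinsPlay₁ κ t v i j σ τ

/-- `τ` is a winning strategy of the second player. -/
def Winning₂ (κ : ℕ) (t : WTree) (v : List ℕ) (i j : ℤ) (τ : Strategy t) : Prop :=
  ∀ σ, WinsPlay₂ κ t v i j σ τ

/-- The first player wins the game. -/
def Win (κ : ℕ) (t : WTree) (v : List ℕ) (i j : ℤ) : Prop :=
  ∃ σ, Winning₁ κ t v i j σ

/-- The first player loses the game. -/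
def Loss (κ : ℕ) (t : WTree) (v : List ℕ) (i j : ℤ) : Prop :=
  ∃ τ, Winning₂ κ t v i j τ

/-- The game is a draw. -/
def Draw (κ : ℕ) (t : WTree) (v : List ℕ) (i j : ℤ) : Prop :=
  ¬ Win κ t v i j ∧ ¬ Loss κ t v i j

open Classical in
/-- The duration of the game: the number of moves when the winner plays a winning strategy that ends
the game as quickly as possible and the loser prolongs it as much as possible, and `⊤` if the game
is a draw. -/
noncomputable def duration (κ : ℕ) (t : WTree) (v : List ℕ) (i j : ℤ) : ℕ∞ :=
  if Win κ t v i j then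
    ⨅ (σ : Strategy t) (_ : Winning₁ κ t v i j σ), ⨆ τ : Strategy t, playDuration κ t v i j σ τ
  else if Loss κ t v i j then
    ⨅ (τ : Strategy t) (_ : Winning₂ κ t v i j τ), ⨆ σ : Strategy t, playDuration κ t v i j σ τ
  else ⊤

/-! ### The game on the Galton-Watson tree with random edge weights -/

/-- The law of the rooted Galton-Watson tree with offspring distribution `χ` whose edges carry
weights with law `p`: all offspring numbers and all edge weights are independent. -/
noncomputable def treeLaw (χ : PMF ℕ) (p : PMF ℤ) : Measure WTree :=
  Measure.infinitePi (fun _ : List ℕ => χ.toMeasure.prod p.toMeasure)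

/-- The probability that the first player wins the game that starts at the root. -/
noncomputable def winProb (κ : ℕ) (χ : PMF ℕ) (p : PMF ℤ) (i j : ℤ) : ℝ :=
  (treeLaw χ p).real {t | Win κ t [] i j}

/-- The probability that the first player loses the game that starts at the root. -/
noncomputable def lossProb (κ : ℕ) (χ : PMF ℕ) (p : PMF ℤ) (i j : ℤ) : ℝ :=
  (treeLaw χ p).real {t | Loss κ t [] i j}

/-- The probability that the game that starts at the root is a draw. -/
noncomputable def drawProb (κ : ℕ) (χ : PMF ℕ) (p : PMF ℤ) (i j : ℤ) : ℝ :=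
  (treeLaw χ p).real {t | Draw κ t [] i j}

/-- The expected duration of the game that starts at the root. -/
noncomputable def expectedDuration (κ : ℕ) (χ : PMF ℕ) (p : PMF ℤ) (i j : ℤ) : ℝ≥0∞ :=
  ∫⁻ t, (duration κ t [] i j : ℝ≥0∞) ∂(treeLaw χ p)

/-- The probability generating function of the offspring distribution. -/
noncomputable def pgf (χ : PMF ℕ) (x : ℝ) : ℝ := ∑' m : ℕ, x ^ m * (χ m).toReal

noncomputable def alpha (κ : ℕ) (χ : PMF ℕ) (p : PMF ℤ) (i j : ℤ) : ℝ :=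
  (p (-1)).toReal * winProb κ χ p j (i - 1) + (p 0).toReal * winProb κ χ p j i
    + (p 1).toReal * winProb κ χ p j (i + 1)

noncomputable def beta (κ : ℕ) (χ : PMF ℕ) (p : PMF ℤ) (i j : ℤ) : ℝ :=
  (p (-1)).toReal * (1 - lossProb κ χ p j (i - 1)) + (p 0).toReal * (1 - lossProb κ χ p j i)
    + (p 1).toReal * (1 - lossProb κ χ p j (i + 1))

/-- The coefficient with upper index `(i, j)` and lower index `(s, t)`. -/
noncomputable def coeff (κ : ℕ) (χ : PMF ℕ) (p : PMF ℤ) (i j s t : ℤ) : ℝ :=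
  if (s = i - 1 ∨ s = i ∨ s = i + 1) ∧ (t = j - 1 ∨ t = j ∨ t = j + 1) then
    deriv (pgf χ) (beta κ χ p s t) * deriv (pgf χ) (alpha κ χ p t i)
      * (p (i - s)).toReal * (p (j - t)).toReal
  else 0

end WeightedTreeGame

-- Let `G` be the offspring generating function, `X` an edge weight, and let `W_n`, `L_n` be the
-- probabilities that the first player can force a win, respectively be forced to lose, within `n`
-- moves. Branching is finite, so a player against whom no win can be forced in bounded time can
-- keep it that way forever (`not_winsAt_safeStrategy`). Hence every game that is won or lost is so
-- within some bound, and `W_n`, `L_n` increase to the probabilities `w`, `ℓ`.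
--
-- The subtrees at the children of the root are independent copies of the tree
-- (`map_graft_treeLaw`). At interior capitals this gives `L_{n+1}(i,j) = G(E W_n(j,i+X))` and
-- `W_{n+1}(i,j) = 1 - G(1 - E L_n(j,i+X))`.
--
-- By convexity, `G(y) - G(x) ≤ G'(y)(y - x)` for `0 ≤ x ≤ y < 1` (`pgf_sub_le`). Applied to the
-- gaps `w - W_n` and `ℓ - L_n`, this bounds each loss gap by `G'(α)` times a mean of earlier win
-- gaps, and each win gap by `G'(β_n)` times a mean of earlier loss gaps, where `β_n` decreases to
-- `β`. Two steps thus act on the win gaps through a matrix converging to the coefficients of the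
-- theorem. The hypothesis says that the column sums of the limit are below 1, so the total win gap
-- eventually contracts by a fixed factor every two steps and is summable (`summable_sum_winGap`).
-- One further step makes the loss gaps summable. All this takes place strictly inside the unit
-- interval, where `G'` is continuous, since every interior state is won and lost with positive
-- probability (`exists_probIn_pos`).
--
-- Without draws, the probability that nothing is decided within `n` moves is the sum of the two
-- gaps, and the expected duration is at most the sum of these probabilities over `n`.

namespace WeightedTreeGame

/-! ### Subtrees and the first step of a play -/

/-- The subtree rooted at the child `c` of the root. Its root label keeps the weight of the edge
leading to `c`. -/
def subtree (t : WTree) (c : ℕ) : WTree := fun u => t (c :: u)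

/-- The restriction of a strategy to the subtree rooted at the child `c` of the root. -/
def Strategy.restrict {t : WTree} (σ : Strategy t) (c : ℕ) : Strategy (subtree t c) :=
  ⟨fun u => σ.1 (c :: u), fun u hu => σ.2 (c :: u) hu⟩

/-- The strategy that moves to `a` at the root and uses `f c` in the subtree rooted at `c`. -/
def Strategy.glue {t : WTree} (a : ℕ) (ha : 0 < numChildren t [] → a < numChildren t [])
    (f : ∀ c, Strategy (subtree t c)) : Strategy t :=
  ⟨fun v => match v with
    | [] => a
    | c :: u => (f c).1 u,
   fun v => match v with
    | [] => ha
    | c :: u => (f c).2 u⟩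

/-- A position in the subtree rooted at `c`, seen from the whole tree. -/
def Position.lift (c : ℕ) (q : Position) : Position := ⟨c :: q.vertex, q.capital₂, q.capital₁⟩

/-- The second player is the first to move in the subtree, so strategies, capitals and the parity of
the move counter all trade roles. -/
theorem play_succ (t : WTree) (i j : ℤ) (σ τ : Strategy t) (n : ℕ) :
    play t [] i j σ τ (n + 1) =
      (play (subtree t (σ.1 [])) [] j (i + weight t [σ.1 []])
        (τ.restrict (σ.1 [])) (σ.restrict (σ.1 [])) n).lift (σ.1 []) := by
  induction n with
  | zero => simp [play, Position.lift]
  | succ n ih =>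
    rw [play, ih]
    conv_rhs => rw [play]
    by_cases h : Even n
    · have h' : ¬ Even (n + 1) := by simpa [Nat.even_add_one] using h
      simp [h, h', Position.lift, Strategy.restrict, weight, subtree]
    · have h' : Even (n + 1) := by simpa [Nat.even_add_one] using h
      simp [h, h', Position.lift, Strategy.restrict, weight, subtree]

theorem won₁_lift (κ : ℕ) (t : WTree) (c n : ℕ) (q : Position) :
    Won₁ κ t (n + 1) (q.lift c) ↔ Won₂ κ (subtree t c) n q := by
  simp [Won₁, Won₂, Position.lift, numChildren, subtree, Nat.odd_add_one]

theorem won₂_lift (κ : ℕ) (t : WTree) (c n : ℕ) (q : Position) :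
    Won₂ κ t (n + 1) (q.lift c) ↔ Won₁ κ (subtree t c) n q := by
  simp [Won₁, Won₂, Position.lift, numChildren, subtree, Nat.even_add_one]

theorem over_lift (κ : ℕ) (t : WTree) (c n : ℕ) (q : Position) :
    Over κ t (n + 1) (q.lift c) ↔ Over κ (subtree t c) n q := by
  rw [Over, Over, won₁_lift, won₂_lift, or_comm]

/-! ### Plays that are won at a given time -/

/-- The play of `σ` against `τ` ends after exactly `n` moves, and the first player wins it. -/
def WinsAt₁ (κ : ℕ) (t : WTree) (i j : ℤ) (σ τ : Strategy t) (n : ℕ) : Prop :=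
  Won₁ κ t n (play t [] i j σ τ n) ∧ ∀ m < n, ¬ Over κ t m (play t [] i j σ τ m)

/-- The play of `σ` against `τ` ends after exactly `n` moves, and the second player wins it. -/
def WinsAt₂ (κ : ℕ) (t : WTree) (i j : ℤ) (σ τ : Strategy t) (n : ℕ) : Prop :=
  Won₂ κ t n (play t [] i j σ τ n) ∧ ∀ m < n, ¬ Over κ t m (play t [] i j σ τ m)

variable {κ : ℕ} {t : WTree} {i j : ℤ}

theorem winsAt₁_zero (σ τ : Strategy t) (hi : i ≠ κ) :
    WinsAt₁ κ t i j σ τ 0 ↔ j = 0 := by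
  simp [WinsAt₁, Won₁, play, hi]

theorem winsAt₂_zero (σ τ : Strategy t) (hi : i ≠ 0) (hi' : i ≠ κ) :
    WinsAt₂ κ t i j σ τ 0 ↔ j = κ ∨ (j ≠ 0 ∧ numChildren t [] = 0) := by
  simp [WinsAt₂, Won₂, play, hi, hi']

theorem over_zero_iff (σ τ : Strategy t) (hi : i ≠ 0) (hi' : i ≠ κ) :
    Over κ t 0 (play t [] i j σ τ 0) ↔ j = 0 ∨ j = κ ∨ numChildren t [] = 0 := by
  simp only [Over, Won₁, Won₂, play, hi, hi']
  simp
  tauto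

theorem winsAt₁_succ (σ τ : Strategy t) (hi : i ≠ 0) (hi' : i ≠ κ) (n : ℕ) :
    WinsAt₁ κ t i j σ τ (n + 1) ↔ (j ≠ 0 ∧ j ≠ κ ∧ 0 < numChildren t []) ∧
      WinsAt₂ κ (subtree t (σ.1 [])) j (i + weight t [σ.1 []])
        (τ.restrict (σ.1 [])) (σ.restrict (σ.1 [])) n := by
  rw [WinsAt₁, WinsAt₂, play_succ, won₁_lift, Nat.forall_lt_succ_left, over_zero_iff σ τ hi hi']
  simp only [play_succ, over_lift, Nat.pos_iff_ne_zero]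
  tauto

theorem winsAt₂_succ (σ τ : Strategy t) (hi : i ≠ 0) (hi' : i ≠ κ) (n : ℕ) :
    WinsAt₂ κ t i j σ τ (n + 1) ↔ (j ≠ 0 ∧ j ≠ κ ∧ 0 < numChildren t []) ∧
      WinsAt₁ κ (subtree t (σ.1 [])) j (i + weight t [σ.1 []])
        (τ.restrict (σ.1 [])) (σ.restrict (σ.1 [])) n := by
  rw [WinsAt₁, WinsAt₂, play_succ, won₂_lift, Nat.forall_lt_succ_left, over_zero_iff σ τ hi hi']
  simp only [play_succ, over_lift, Nat.pos_iff_ne_zero]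
  tauto

/-! ### Games decided within a bounded number of moves -/

mutual
/-- The player who moves first can force a win within `n` moves; her capital `i` is assumed to be
neither `0` nor `κ`. -/
def WinIn (κ : ℕ) : ℕ → WTree → ℤ → ℤ → Prop
  | 0, _, _, j => j = 0
  | n + 1, t, i, j => j = 0 ∨ (j ≠ κ ∧ ∃ c < numChildren t [],
      LossIn κ n (subtree t c) j (i + weight t [c]))
/-- The player who moves second can force a win within `n` moves, where a first player who starts
at a leaf only counts as beaten for `1 ≤ n`. -/
def LossIn (κ : ℕ) : ℕ → WTree → ℤ → ℤ → Prop
  | 0, _, _, j => j = κ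
  | n + 1, t, i, j => j = κ ∨ (j ≠ 0 ∧ ∀ c < numChildren t [],
      WinIn κ n (subtree t c) j (i + weight t [c]))
end

theorem winIn_zero : WinIn κ 0 t i j ↔ j = 0 := by rw [WinIn]

theorem lossIn_zero : LossIn κ 0 t i j ↔ j = κ := by rw [LossIn]

theorem winIn_succ {n : ℕ} : WinIn κ (n + 1) t i j ↔ j = 0 ∨ (j ≠ κ ∧ ∃ c < numChildren t [],
    LossIn κ n (subtree t c) j (i + weight t [c])) := by rw [WinIn]

theorem lossIn_succ {n : ℕ} : LossIn κ (n + 1) t i j ↔ j = κ ∨ (j ≠ 0 ∧ ∀ c < numChildren t [],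
    WinIn κ n (subtree t c) j (i + weight t [c])) := by rw [LossIn]

theorem winIn_lossIn_succ (n : ℕ) : ∀ (t : WTree) (i j : ℤ),
    (WinIn κ n t i j → WinIn κ (n + 1) t i j) ∧ (LossIn κ n t i j → LossIn κ (n + 1) t i j) := by
  induction n with
  | zero =>
    intro t i j
    rw [winIn_succ, lossIn_succ, winIn_zero, lossIn_zero]
    exact ⟨Or.inl, Or.inl⟩
  | succ n ih =>
    intro t i j
    rw [winIn_succ, lossIn_succ, winIn_succ (n := n + 1), lossIn_succ (n := n + 1)]
    exact ⟨Or.imp_right fun ⟨h, c, hc, hl⟩ => ⟨h, c, hc, (ih _ _ _).2 hl⟩,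
      Or.imp_right fun ⟨h, hl⟩ => ⟨h, fun c hc => (ih _ _ _).1 (hl c hc)⟩⟩

theorem monotone_winIn (t : WTree) (i j : ℤ) : Monotone fun n => WinIn κ n t i j :=
  monotone_nat_of_le_succ fun n => (winIn_lossIn_succ n t i j).1

theorem monotone_lossIn (t : WTree) (i j : ℤ) : Monotone fun n => LossIn κ n t i j :=
  monotone_nat_of_le_succ fun n => (winIn_lossIn_succ n t i j).2

/-- A common horizon suffices because both predicates are monotone in it. That `κ` is not `0` keeps
the terminal conditions `j = 0` and `j = κ` apart. -/
theorem WinIn.not_lossIn {n : ℕ} (hj : (κ : ℤ) ≠ 0) : ∀ {t : WTree} {i j : ℤ},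
    WinIn κ n t i j → ¬ LossIn κ n t i j := by
  suffices ∀ (n : ℕ) (t : WTree) (i j : ℤ), ¬ (WinIn κ n t i j ∧ LossIn κ n t i j) from
    fun {_ _ _} h h' => this _ _ _ _ ⟨h, h'⟩
  intro n
  induction n with
  | zero =>
    rintro t i j ⟨h, h'⟩
    rw [winIn_zero] at h
    rw [lossIn_zero, h] at h'
    exact hj h'.symm
  | succ n ih =>
    rintro t i j ⟨h, h'⟩
    rw [winIn_succ] at h
    rw [lossIn_succ] at h'
    rcases h with rfl | ⟨h1, c, hc, hl⟩
    · rcases h' with h' | h'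
      · exact hj h'.symm
      · exact h'.1 rfl
    · rcases h' with h' | h'
      · exact h1 h'
      · exact ih _ _ _ ⟨h'.2 c hc, hl⟩

/-- A strategy that always moves to the first child. -/
def Strategy.first (t : WTree) : Strategy t := ⟨fun _ => 0, fun _ h => h⟩

/-- Induction on the horizon: strategies for the subtrees, with the roles exchanged, are glued
together at the root. -/
theorem exists_strategy_of_decided (n : ℕ) : ∀ (t : WTree) (i j : ℤ), i ≠ 0 → i ≠ κ →
    (WinIn κ n t i j → ∃ σ, ∀ τ, ∃ m ≤ n, WinsAt₁ κ t i j σ τ m) ∧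
    (LossIn κ n t i j → ∃ τ, ∀ σ, ∃ m ≤ n, WinsAt₂ κ t i j σ τ m) := by
  induction n with
  | zero =>
    intro t i j h0 hκ
    refine ⟨fun h => ⟨Strategy.first t, fun τ => ⟨0, le_rfl, ?_⟩⟩,
      fun h => ⟨Strategy.first t, fun σ => ⟨0, le_rfl, ?_⟩⟩⟩
    · rwa [winsAt₁_zero _ _ hκ, ← winIn_zero (κ := κ) (t := t) (i := i)]
    · rw [winsAt₂_zero _ _ h0 hκ]
      exact Or.inl (lossIn_zero.1 h)
  | succ n ih =>
    intro t i j h0 hκ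
    constructor
    · intro h
      rcases eq_or_ne j 0 with hj | hj
      · exact ⟨Strategy.first t, fun τ => ⟨0, Nat.zero_le _, (winsAt₁_zero _ _ hκ).2 hj⟩⟩
      rw [winIn_succ] at h
      obtain ⟨hjκ, c, hc, hl⟩ := h.resolve_left hj
      obtain ⟨ρ, hρ⟩ := (ih _ _ _ hj hjκ).2 hl
      classical
      -- Play enters only the subtree at `c`; in the others any strategy will do.
      let f : ∀ d, Strategy (subtree t d) := fun d =>
        if hd : d = c then hd ▸ ρ else Strategy.first _
      have hf : f c = ρ := by simp [f]
      refine ⟨Strategy.glue c (fun _ => hc) f, fun τ => ?_⟩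
      obtain ⟨m, hm, hw⟩ := hρ (τ.restrict c)
      refine ⟨m + 1, Nat.succ_le_succ hm, (winsAt₁_succ _ _ h0 hκ m).2 ⟨⟨hj, hjκ, by omega⟩, ?_⟩⟩
      rw [← hf] at hw
      exact hw
    · intro h
      rcases eq_or_ne j κ with hj | hj
      · exact ⟨Strategy.first t, fun τ => ⟨0, Nat.zero_le _, (winsAt₂_zero _ _ h0 hκ).2 (Or.inl hj)⟩⟩
      rw [lossIn_succ] at h
      obtain ⟨hj0, hl⟩ := h.resolve_left hj
      have hex : ∀ c, ∃ ρ : Strategy (subtree t c), c < numChildren t [] →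
          ∀ τ, ∃ m ≤ n, WinsAt₁ κ (subtree t c) j (i + weight t [c]) ρ τ m := by
        intro c
        by_cases hc : c < numChildren t []
        · obtain ⟨ρ, hρ⟩ := (ih _ _ _ hj0 hj).1 (hl c hc)
          exact ⟨ρ, fun _ => hρ⟩
        · exact ⟨Strategy.first _, fun h => absurd h hc⟩
      choose f hf using hex
      -- The root value `0` is a dummy, since the second player never moves from the root.
      refine ⟨Strategy.glue 0 id f, fun σ => ?_⟩
      rcases Nat.eq_zero_or_pos (numChildren t []) with hz | hz
      · exact ⟨0, Nat.zero_le _, (winsAt₂_zero _ _ h0 hκ).2 (Or.inr ⟨hj0, hz⟩)⟩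
      obtain ⟨m, hm, hw⟩ := hf (σ.1 []) (σ.2 _ hz) (σ.restrict (σ.1 []))
      exact ⟨m + 1, Nat.succ_le_succ hm, (winsAt₂_succ _ _ h0 hκ m).2 ⟨⟨hj0, hj, hz⟩, hw⟩⟩

theorem WinIn.win {n : ℕ} (hi : i ≠ 0) (hi' : i ≠ κ) (h : WinIn κ n t i j) : Win κ t [] i j := by
  obtain ⟨σ, hσ⟩ := (exists_strategy_of_decided n t i j hi hi').1 h
  exact ⟨σ, fun τ => let ⟨m, _, hm⟩ := hσ τ; ⟨m, hm⟩⟩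

theorem LossIn.loss {n : ℕ} (hi : i ≠ 0) (hi' : i ≠ κ) (h : LossIn κ n t i j) :
    Loss κ t [] i j := by
  obtain ⟨σ, hσ⟩ := (exists_strategy_of_decided n t i j hi hi').2 h
  exact ⟨σ, fun τ => let ⟨m, _, hm⟩ := hσ τ; ⟨m, hm⟩⟩

/-! ### Avoiding defeat in undecided games -/

open Classical in
/-- A move, if there is one, to a child from which the opponent cannot force a win in bounded
time. -/
noncomputable def safeMove (κ : ℕ) (t : WTree) (i j : ℤ) : ℕ :=
  if h : ∃ c < numChildren t [], ∀ n, ¬ WinIn κ n (subtree t c) j (i + weight t [c])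
  then h.choose else 0

/-- The vertexwise choice of safe moves. -/
noncomputable def safeMoves (κ : ℕ) : List ℕ → WTree → ℤ → ℤ → ℕ
  | [], t, i, j => safeMove κ t i j
  | c :: u, t, i, j => safeMoves κ u (subtree t c) j (i + weight t [c])

theorem safeMove_lt (h : 0 < numChildren t []) : safeMove κ t i j < numChildren t [] := by
  unfold safeMove
  split_ifs with h'
  · exact h'.choose_spec.1
  · exact h

theorem safeMoves_lt (v : List ℕ) : ∀ (t : WTree) (i j : ℤ), 0 < numChildren t v →
    safeMoves κ v t i j < numChildren t v := by
  induction v with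
  | nil => exact fun t i j h => safeMove_lt h
  | cons c u ih => exact fun t i j h => ih (subtree t c) _ _ h

/-- The strategy, usable by either player, of always making safe moves. -/
noncomputable def safeStrategy (κ : ℕ) (t : WTree) (i j : ℤ) : Strategy t :=
  ⟨fun v => safeMoves κ v t i j, fun v h => safeMoves_lt v t i j h⟩

/-- This is where finite branching enters: if each of the finitely many children allowed a forced
win in bounded time, the largest of these bounds would serve for all of them. -/
theorem not_winIn_safeMove (hj : j ≠ 0)
    (h : ∀ n, ¬ LossIn κ n t i j) (n : ℕ) :
    ¬ WinIn κ n (subtree t (safeMove κ t i j)) j (i + weight t [safeMove κ t i j]) := by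
  have hex : ∃ c < numChildren t [], ∀ n, ¬ WinIn κ n (subtree t c) j (i + weight t [c]) := by
    by_contra! hcon
    have hcon' : ∀ c, ∃ n, c < numChildren t [] →
        WinIn κ n (subtree t c) j (i + weight t [c]) := by
      intro c
      by_cases hc : c < numChildren t []
      · exact (hcon c hc).imp fun n hn _ => hn
      · exact ⟨0, fun h => absurd h hc⟩
    choose N hN using hcon'
    refine h ((Finset.range (numChildren t [])).sup N + 1) (lossIn_succ.2 (Or.inr ⟨hj, ?_⟩))
    exact fun c hc => monotone_winIn _ _ _ (Finset.le_sup (Finset.mem_range.2 hc)) (hN c hc)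
  have : safeMove κ t i j = hex.choose := by
    unfold safeMove
    rw [dif_pos hex]
  rw [this]
  exact hex.choose_spec.2 n

/-- The absence of a bounded forced win for the opponent is preserved by every move of the opponent
and by each safe move. Restricting `safeStrategy` to a subtree gives, by definition, the safe
strategy for the capitals reached there, so the induction on the length of the play applies
directly. -/
theorem not_winsAt_safeStrategy (m : ℕ) : ∀ (t : WTree) (i j : ℤ), i ≠ 0 → i ≠ κ →
    ((∀ n, ¬ WinIn κ n t i j) → ∀ σ, ¬ WinsAt₁ κ t i j σ (safeStrategy κ t i j) m) ∧
    ((∀ n, ¬ LossIn κ n t i j) → ∀ τ, ¬ WinsAt₂ κ t i j (safeStrategy κ t i j) τ m) := by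
  induction m with
  | zero =>
    intro t i j h0 hκ
    refine ⟨fun h σ => ?_, fun h τ => ?_⟩
    · rw [winsAt₁_zero _ _ hκ, ← winIn_zero (κ := κ) (t := t) (i := i)]
      exact h 0
    · rw [winsAt₂_zero _ _ h0 hκ]
      rintro (hj | ⟨hj, hz⟩)
      · exact h 0 (lossIn_zero.2 hj)
      -- A leaf counts as a loss only from horizon 1 on, where the condition on the children is
      -- vacuous.
      · exact h 1 (lossIn_succ.2 (Or.inr ⟨hj, by simp [hz]⟩))
  | succ m ih =>
    intro t i j h0 hκ
    refine ⟨fun h σ hw => ?_, fun h τ hw => ?_⟩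
    · obtain ⟨⟨hj, hjκ, hz⟩, hw⟩ := (winsAt₁_succ _ _ h0 hκ m).1 hw
      refine (ih _ _ _ hj hjκ).2 (fun n hl => ?_) _ hw
      exact h (n + 1) (winIn_succ.2 (Or.inr ⟨hjκ, _, σ.2 [] hz, hl⟩))
    · obtain ⟨⟨hj, hjκ, hz⟩, hw⟩ := (winsAt₂_succ _ _ h0 hκ m).1 hw
      exact (ih _ _ _ hj hjκ).1 (not_winIn_safeMove hj h) _ hw

/-- This replaces the quantifiers over strategies by an increasing countable union, which yields
both measurability and convergence of the probabilities. -/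
theorem win_iff_exists_winIn (hi : i ≠ 0) (hi' : i ≠ κ) :
    Win κ t [] i j ↔ ∃ n, WinIn κ n t i j := by
  refine ⟨fun ⟨σ, hσ⟩ => ?_, fun ⟨n, hn⟩ => hn.win hi hi'⟩
  by_contra! hcon
  obtain ⟨m, hm⟩ := hσ (safeStrategy κ t i j)
  exact (not_winsAt_safeStrategy m t i j hi hi').1 hcon σ hm

theorem loss_iff_exists_lossIn (hi : i ≠ 0) (hi' : i ≠ κ) :
    Loss κ t [] i j ↔ ∃ n, LossIn κ n t i j := by
  refine ⟨fun ⟨τ, hτ⟩ => ?_, fun ⟨n, hn⟩ => hn.loss hi hi'⟩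
  by_contra! hcon
  obtain ⟨m, hm⟩ := hτ (safeStrategy κ t i j)
  exact (not_winsAt_safeStrategy m t i j hi hi').2 hcon τ hm

theorem not_win_and_loss (hκ : (κ : ℤ) ≠ 0) (hi : i ≠ 0) (hi' : i ≠ κ) :
    ¬ (Win κ t [] i j ∧ Loss κ t [] i j) := by
  rw [win_iff_exists_winIn hi hi', loss_iff_exists_lossIn hi hi']
  rintro ⟨⟨n, hn⟩, m, hm⟩
  exact (monotone_winIn t i j (le_max_left n m) hn : WinIn κ (max n m) t i j).not_lossIn hκ
    (monotone_lossIn t i j (le_max_right n m) hm)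

theorem duration_le_of_winIn {n : ℕ} (hi : i ≠ 0) (hi' : i ≠ κ) (h : WinIn κ n t i j) :
    duration κ t [] i j ≤ n := by
  rw [duration, if_pos (h.win hi hi')]
  obtain ⟨σ, hσ⟩ := (exists_strategy_of_decided n t i j hi hi').1 h
  refine iInf₂_le_of_le σ (fun τ => let ⟨m, _, hm⟩ := hσ τ; ⟨m, hm⟩) (iSup_le fun τ => ?_)
  obtain ⟨m, hm, hw⟩ := hσ τ
  exact iInf₂_le_of_le m (Or.inl hw.1) (by exact_mod_cast hm)

theorem duration_le_of_lossIn {n : ℕ} (hκ : (κ : ℤ) ≠ 0) (hi : i ≠ 0) (hi' : i ≠ κ)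
    (h : LossIn κ n t i j) : duration κ t [] i j ≤ n := by
  have hl := h.loss hi hi'
  rw [duration, if_neg fun hw => not_win_and_loss hκ hi hi' ⟨hw, hl⟩, if_pos hl]
  obtain ⟨τ, hτ⟩ := (exists_strategy_of_decided n t i j hi hi').2 h
  refine iInf₂_le_of_le τ (fun σ => let ⟨m, _, hm⟩ := hτ σ; ⟨m, hm⟩) (iSup_le fun σ => ?_)
  obtain ⟨m, hm, hw⟩ := hτ σ
  exact iInf₂_le_of_le m (Or.inr hw.1) (by exact_mod_cast hm)

end WeightedTreeGame

namespace WeightedTreeGame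

/-! ### The branching property of the tree law -/

/-- The tree with root label `a` whose subtree at the child `c` of the root is `s c`. -/
def graft (a : ℕ × ℤ) (s : ℕ → WTree) : WTree
  | [] => a
  | c :: u => s c u

theorem measurable_graft :
    Measurable fun x : (ℕ × ℤ) × (ℕ → WTree) => graft x.1 x.2 := by
  refine measurable_pi_iff.2 fun v => ?_
  cases v with
  | nil => exact measurable_fst
  | cons c u => exact (measurable_pi_apply u).comp ((measurable_pi_apply c).comp measurable_snd)

theorem measurable_subtree (c : ℕ) : Measurable fun t : WTree => subtree t c :=
  measurable_pi_iff.2 fun _ => measurable_pi_apply _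

instance (χ : PMF ℕ) (p : PMF ℤ) : IsProbabilityMeasure (treeLaw χ p) := by
  unfold treeLaw
  infer_instance

theorem measurableSet_pi_finset (s : Finset (List ℕ)) {B : List ℕ → Set (ℕ × ℤ)}
    (hB : ∀ v, MeasurableSet (B v)) : MeasurableSet (Set.pi (s : Set (List ℕ)) B) :=
  MeasurableSet.pi s.countable_toSet fun v _ => hB v

theorem cons_injective : Function.Injective fun x : ℕ × List ℕ => x.1 :: x.2 := by
  rintro ⟨c, u⟩ ⟨c', u'⟩ h
  simpa using h

theorem prod_eq_root_mul_prod_cons (s : Finset (List ℕ)) (f : List ℕ → ℝ≥0∞) :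
    ∏ v ∈ s, f v = (if [] ∈ s then f [] else 1) *
      ∏ x ∈ s.preimage (fun x : ℕ × List ℕ => x.1 :: x.2) cons_injective.injOn,
        f (x.1 :: x.2) := by
  classical
  rw [Finset.prod_preimage' (fun x : ℕ × List ℕ => x.1 :: x.2) s cons_injective.injOn f,
    ← Finset.prod_filter_not_mul_prod_filter s
      (fun v => v ∈ Set.range fun x : ℕ × List ℕ => x.1 :: x.2)]
  congr 1
  have h : ∀ v : List ℕ, (v ∉ Set.range fun x : ℕ × List ℕ => x.1 :: x.2) ↔ v = [] := by
    intro v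
    cases v <;> simp
  simp only [h]
  split_ifs with hs
  · have hfilter : s.filter (fun v => v = []) = {[]} := by
      ext v
      simpa using fun hv : v = [] => hv ▸ hs
    convert! Finset.prod_singleton f []
  · rw [Finset.prod_eq_one]
    intro v hv
    rw [Finset.mem_filter] at hv
    exact absurd (hv.2 ▸ hv.1) hs

/-- A product measure is determined by finite boxes. A box splits into a condition on the root label
and conditions on the vertices `c :: u`, and currying turns the product over the pairs `(c, u)` into
a product over `c` of tree laws. -/
theorem map_graft_treeLaw (χ : PMF ℕ) (p : PMF ℤ) :
    ((χ.toMeasure.prod p.toMeasure).prod (Measure.infinitePi fun _ : ℕ => treeLaw χ p)).map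
      (fun x => graft x.1 x.2) = treeLaw χ p := by
  set ν := χ.toMeasure.prod p.toMeasure
  refine Measure.eq_infinitePi (fun _ : List ℕ => ν) fun s B hB => ?_
  classical
  have hinj := cons_injective.injOn (s := (fun x : ℕ × List ℕ => x.1 :: x.2) ⁻¹' (s : Set (List ℕ)))
  rw [Measure.map_apply measurable_graft (measurableSet_pi_finset s hB)]
  have hpre : (fun x : (ℕ × ℤ) × (ℕ → WTree) => graft x.1 x.2) ⁻¹' Set.pi s B =
      (if [] ∈ s then B [] else Set.univ) ×ˢ ((MeasurableEquiv.curry ℕ (List ℕ) (ℕ × ℤ)).symm ⁻¹'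
        (Set.pi (s.preimage (fun x : ℕ × List ℕ => x.1 :: x.2) hinj : Set (ℕ × List ℕ))
          fun x => B (x.1 :: x.2))) := by
    ext ⟨a, f⟩
    simp only [Set.mem_preimage, Set.mem_pi, Set.mem_prod, Finset.mem_coe, Finset.mem_preimage,
      MeasurableEquiv.coe_curry_symm, Function.uncurry, Prod.forall]
    constructor
    · intro h
      refine ⟨?_, fun c u hcu => h (c :: u) hcu⟩
      split_ifs with hs
      · exact h [] hs
      · trivial
    · rintro ⟨h1, h2⟩ v hv
      cases v with
      | nil =>
        rw [if_pos hv] at h1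
        exact h1
      | cons c u => exact h2 c u hv
  have hmeas : MeasurableSet
      (Set.pi (s.preimage (fun x : ℕ × List ℕ => x.1 :: x.2) hinj : Set (ℕ × List ℕ))
        fun x => B (x.1 :: x.2)) :=
    MeasurableSet.pi (Finset.countable_toSet _) fun x _ => hB _
  rw [hpre, Measure.prod_prod, ← Measure.map_apply (MeasurableEquiv.measurable _) hmeas]
  have hcurry := Measure.infinitePi_map_curry_symm (fun (_ : ℕ) (_ : List ℕ) => ν)
  simp only [treeLaw]
  rw [hcurry, Measure.infinitePi_pi _ fun x _ => hB _, prod_eq_root_mul_prod_cons]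
  congr 1
  split_ifs <;> simp [ν]

theorem measurableSet_root_and_subtrees {E : Set WTree} (hE : MeasurableSet E) (m : ℕ) :
    MeasurableSet {t : WTree | numChildren t [] = m ∧ ∀ c < m, subtree t c ∈ E} := by
  have hset : {t : WTree | numChildren t [] = m ∧ ∀ c < m, subtree t c ∈ E} =
      (fun t : WTree => (t []).1) ⁻¹' {m} ∩ ⋂ c ∈ Set.Iio m, (subtree · c) ⁻¹' E := by
    ext t
    simp [numChildren]
  rw [hset]
  exact ((measurable_fst.comp (measurable_pi_apply [])) (MeasurableSet.singleton m)).inter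
    (MeasurableSet.biInter (Set.to_countable _) fun c _ => measurable_subtree c hE)

theorem measure_root_and_subtrees (χ : PMF ℕ) (p : PMF ℤ) {E : Set WTree} (hE : MeasurableSet E)
    (m : ℕ) : treeLaw χ p {t | numChildren t [] = m ∧ ∀ c < m, subtree t c ∈ E} =
      χ m * treeLaw χ p E ^ m := by
  conv_lhs => rw [← map_graft_treeLaw,
    Measure.map_apply measurable_graft (measurableSet_root_and_subtrees hE m)]
  have hpre : (fun x : (ℕ × ℤ) × (ℕ → WTree) => graft x.1 x.2) ⁻¹'
      {t | numChildren t [] = m ∧ ∀ c < m, subtree t c ∈ E} =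
      (({m} : Set ℕ) ×ˢ (Set.univ : Set ℤ)) ×ˢ
        (Set.pi (Finset.range m : Set ℕ) fun _ => E) := by
    ext ⟨⟨a, b⟩, f⟩
    simp only [numChildren, Set.preimage_ofPred_eq, graft, Set.mem_ofPred_eq, Set.mem_prod,
      Set.mem_singleton_iff, Set.mem_univ, and_true, Set.mem_pi, Finset.mem_coe, Finset.mem_range]
    rfl
  rw [hpre, Measure.prod_prod, Measure.prod_prod, Measure.infinitePi_pi _ fun _ _ => hE]
  simp [PMF.toMeasure_apply_singleton]

theorem setOf_forall_subtree (E : Set WTree) :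
    {t : WTree | ∀ c < numChildren t [], subtree t c ∈ E} =
      ⋃ m, {t : WTree | numChildren t [] = m ∧ ∀ c < m, subtree t c ∈ E} := by
  ext t
  simp

theorem measurableSet_forall_subtree {E : Set WTree} (hE : MeasurableSet E) :
    MeasurableSet {t : WTree | ∀ c < numChildren t [], subtree t c ∈ E} := by
  rw [setOf_forall_subtree]
  exact MeasurableSet.iUnion fun m => measurableSet_root_and_subtrees hE m

/-- Conditioning on the number `m` of children leaves `m` independent subtrees, hence an `m`-th
power. -/
theorem measureReal_forall_subtree (χ : PMF ℕ) (p : PMF ℤ) {E : Set WTree}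
    (hE : MeasurableSet E) :
    (treeLaw χ p).real {t | ∀ c < numChildren t [], subtree t c ∈ E} =
      pgf χ ((treeLaw χ p).real E) := by
  rw [setOf_forall_subtree, measureReal_def, measure_iUnion _
    fun m => measurableSet_root_and_subtrees hE m]
  · simp only [measure_root_and_subtrees χ p hE, pgf]
    rw [ENNReal.tsum_toReal_eq fun m =>
      ENNReal.mul_ne_top (χ.apply_ne_top m) (ENNReal.pow_ne_top (measure_ne_top _ _))]
    refine tsum_congr fun m => ?_
    rw [ENNReal.toReal_mul, ENNReal.toReal_pow, measureReal_def, mul_comm]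
  · intro m m' hm
    refine Set.disjoint_left.2 fun t ht ht' => hm ?_
    exact ht.1.symm.trans ht'.1

/-! ### Independence of the weight stored at the root -/

/-- A set of trees is insensitive to the weight stored at the root. -/
def RootWeightFree (A : Set WTree) : Prop :=
  ∀ (m : ℕ) (x y : ℤ) (s : ℕ → WTree), graft (m, x) s ∈ A → graft (m, y) s ∈ A

theorem measurableSet_rootWeight (x : ℤ) : MeasurableSet {t : WTree | weight t [] = x} :=
  (measurable_snd.comp (measurable_pi_apply [])) (MeasurableSet.singleton x)

/-- The weight of an edge is stored at the root of the subtree below it. This lemma makes it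
independent of any event there that ignores the root weight. -/
theorem measure_rootWeight_inter (χ : PMF ℕ) (p : PMF ℤ) {A : Set WTree} (hA : MeasurableSet A)
    (hfree : RootWeightFree A) (x : ℤ) :
    treeLaw χ p ({t | weight t [] = x} ∩ A) = p x * treeLaw χ p A := by
  set Q := Measure.infinitePi fun _ : ℕ => treeLaw χ p with hQ
  -- Taking `S` arbitrary allows `S = Set.univ`, which identifies the integral with the measure of
  -- `A`.
  have key : ∀ S : Set ℤ, treeLaw χ p ({t | weight t [] ∈ S} ∩ A) =
      (∫⁻ m, Q {s | graft (m, 0) s ∈ A} ∂χ.toMeasure) * p.toMeasure S := by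
    intro S
    have hm : MeasurableSet ({t : WTree | weight t [] ∈ S} ∩ A) :=
      ((measurable_snd.comp (measurable_pi_apply [])) (MeasurableSet.of_discrete (s := S))).inter hA
    rw [← map_graft_treeLaw, Measure.map_apply measurable_graft hm, ← hQ,
      Measure.prod_apply (measurable_graft hm)]
    have : ∀ a : ℕ × ℤ, Q (Prod.mk a ⁻¹' ((fun x : (ℕ × ℤ) × (ℕ → WTree) => graft x.1 x.2) ⁻¹'
        ({t | weight t [] ∈ S} ∩ A))) = Q {s | graft (a.1, 0) s ∈ A} * S.indicator 1 a.2 := by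
      rintro ⟨m, y⟩
      by_cases hy : y ∈ S
      · simp only [hy, Set.indicator_of_mem, Pi.one_apply, mul_one]
        congr 1
        ext s
        exact ⟨fun h => hfree _ _ _ _ h.2, fun h => ⟨hy, hfree _ _ _ _ h⟩⟩
      · simp only [hy, not_false_eq_true, Set.indicator_of_notMem, mul_zero]
        refine (congrArg Q (Set.eq_empty_of_forall_notMem fun s hs => hy hs.1)).trans measure_empty
    simp only [this]
    rw [lintegral_prod_mul (f := fun m => Q {s | graft (m, 0) s ∈ A}) (g := S.indicator 1)
      (measurable_of_countable _).aemeasurable (measurable_of_countable _).aemeasurable,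
      lintegral_indicator_one MeasurableSet.of_discrete]
  have h1 := key {x}
  have h2 := key Set.univ
  simp only [Set.mem_univ, Set.ofPred_true, Set.univ_inter, measure_univ, mul_one] at h2
  rw [← h2, PMF.toMeasure_apply_singleton _ _ (MeasurableSet.singleton x), mul_comm] at h1
  exact h1

theorem measureReal_rootWeight (χ : PMF ℕ) (p : PMF ℤ) (hp : p.support ⊆ {-1, 0, 1})
    {A : ℤ → Set WTree} (hA : ∀ x, MeasurableSet (A x)) (hfree : ∀ x, RootWeightFree (A x)) :
    (treeLaw χ p).real {t | t ∈ A (weight t [])} =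
      ∑ x ∈ {-1, 0, 1}, (p x).toReal * (treeLaw χ p).real (A x) := by
  have hset : {t | t ∈ A (weight t [])} = ⋃ x, ({t | weight t [] = x} ∩ A x) := by
    ext t
    simp
  rw [hset, measureReal_def, measure_iUnion _ fun x => (measurableSet_rootWeight x).inter (hA x)]
  · simp only [measure_rootWeight_inter χ p (hA _) (hfree _)]
    rw [tsum_eq_sum (s := {-1, 0, 1}), ENNReal.toReal_sum fun x _ =>
      ENNReal.mul_ne_top (p.apply_ne_top x) (measure_ne_top _ _)]
    · simp [ENNReal.toReal_mul, measureReal_def]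
    · intro x hx
      have : p x = 0 := by
        by_contra h
        exact hx (by simpa using hp ((p.mem_support_iff x).2 h))
      rw [this, zero_mul]
  · intro x y hxy
    exact Set.disjoint_left.2 fun t ht ht' => hxy (ht.1.symm.trans ht'.1)

theorem measurableSet_mem_rootWeight {A : ℤ → Set WTree} (hA : ∀ x, MeasurableSet (A x)) :
    MeasurableSet {t | t ∈ A (weight t [])} := by
  have hset : {t | t ∈ A (weight t [])} = ⋃ x, ({t | weight t [] = x} ∩ A x) := by
    ext t
    simp
  rw [hset]
  exact MeasurableSet.iUnion fun x => (measurableSet_rootWeight x).inter (hA x)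

/-! ### The recursion for the probabilities of a bounded win -/

variable {κ : ℕ}

theorem rootWeightFree_winIn (n : ℕ) (i j : ℤ) : RootWeightFree {t | WinIn κ n t i j} := by
  intro m x y s h
  cases n with
  | zero =>
    rw [Set.mem_ofPred_eq, winIn_zero] at h ⊢
    exact h
  | succ n => exact winIn_succ.2 (winIn_succ.1 h)

theorem rootWeightFree_lossIn (n : ℕ) (i j : ℤ) : RootWeightFree {t | LossIn κ n t i j} := by
  intro m x y s h
  cases n with
  | zero =>
    rw [Set.mem_ofPred_eq, lossIn_zero] at h ⊢
    exact h
  | succ n => exact lossIn_succ.2 (lossIn_succ.1 h)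

/-- Writing the existence of a good child as a complement lets `measureReal_forall_subtree` serve
both recursions. -/
theorem setOf_winIn_succ {n : ℕ} {i j : ℤ} (h0 : j ≠ 0) (hκ : j ≠ κ) :
    {t | WinIn κ (n + 1) t i j} = {t : WTree | ∀ c < numChildren t [],
      subtree t c ∈ {s | s ∈ (fun x => {s | LossIn κ n s j (i + x)}) (weight s [])}ᶜ}ᶜ := by
  ext t
  simp only [Set.mem_ofPred_eq, winIn_succ, Set.mem_compl_iff, not_forall, not_not]
  simp [h0, hκ]
  rfl

theorem setOf_lossIn_succ {n : ℕ} {i j : ℤ} (h0 : j ≠ 0) (hκ : j ≠ κ) :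
    {t | LossIn κ (n + 1) t i j} = {t : WTree | ∀ c < numChildren t [],
      subtree t c ∈ {s | s ∈ (fun x => {s | WinIn κ n s j (i + x)}) (weight s [])}} := by
  ext t
  simp only [Set.mem_ofPred_eq, lossIn_succ]
  simp [h0, hκ]
  rfl

theorem winIn_of_eq_zero {n : ℕ} {t : WTree} {i : ℤ} : WinIn κ n t i 0 := by
  cases n with
  | zero => exact winIn_zero.2 rfl
  | succ n => exact winIn_succ.2 (Or.inl rfl)

theorem lossIn_of_eq {n : ℕ} {t : WTree} {i : ℤ} : LossIn κ n t i κ := by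
  cases n with
  | zero => exact lossIn_zero.2 rfl
  | succ n => exact lossIn_succ.2 (Or.inl rfl)

theorem measurableSet_winIn_lossIn (n : ℕ) : ∀ i j : ℤ,
    MeasurableSet {t | WinIn κ n t i j} ∧ MeasurableSet {t | LossIn κ n t i j} := by
  induction n with
  | zero =>
    intro i j
    simp only [winIn_zero, lossIn_zero]
    exact ⟨MeasurableSet.const _, MeasurableSet.const _⟩
  | succ n ih =>
    intro i j
    by_cases h0 : j = 0
    · subst h0
      simp only [winIn_of_eq_zero, lossIn_succ, ne_eq, not_true, false_and, or_false]
      exact ⟨MeasurableSet.const _, MeasurableSet.const _⟩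
    by_cases hκ : j = κ
    · subst hκ
      simp only [lossIn_of_eq, winIn_succ, ne_eq, not_true, false_and, or_false]
      exact ⟨MeasurableSet.const _, MeasurableSet.const _⟩
    rw [setOf_winIn_succ h0 hκ, setOf_lossIn_succ h0 hκ]
    exact ⟨(measurableSet_forall_subtree
      (measurableSet_mem_rootWeight fun x => (ih _ _).2).compl).compl,
      measurableSet_forall_subtree (measurableSet_mem_rootWeight fun x => (ih _ _).1)⟩

theorem measurableSet_winIn (n : ℕ) (i j : ℤ) : MeasurableSet {t | WinIn κ n t i j} :=
  (measurableSet_winIn_lossIn n i j).1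

theorem measurableSet_lossIn (n : ℕ) (i j : ℤ) : MeasurableSet {t | LossIn κ n t i j} :=
  (measurableSet_winIn_lossIn n i j).2

/-- The probability that the first player can force a win within `n` moves. -/
noncomputable def winProbIn (κ : ℕ) (χ : PMF ℕ) (p : PMF ℤ) (n : ℕ) (i j : ℤ) : ℝ :=
  (treeLaw χ p).real {t | WinIn κ n t i j}

/-- The probability that the second player can force a win within `n` moves. -/
noncomputable def lossProbIn (κ : ℕ) (χ : PMF ℕ) (p : PMF ℤ) (n : ℕ) (i j : ℤ) : ℝ :=
  (treeLaw χ p).real {t | LossIn κ n t i j}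

/-- The mean of `f` with respect to the distribution of an edge weight. -/
noncomputable def weightMean (p : PMF ℤ) (f : ℤ → ℝ) : ℝ := ∑ x ∈ {-1, 0, 1}, (p x).toReal * f x

variable (χ : PMF ℕ) (p : PMF ℤ)

theorem winProbIn_succ (hp : p.support ⊆ {-1, 0, 1}) (n : ℕ) {i j : ℤ} (h0 : j ≠ 0)
    (hκ : j ≠ κ) : winProbIn κ χ p (n + 1) i j =
      1 - pgf χ (1 - weightMean p fun x => lossProbIn κ χ p n j (i + x)) := by
  have hE := measurableSet_mem_rootWeight fun x => measurableSet_lossIn (κ := κ) n j (i + x)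
  rw [winProbIn, setOf_winIn_succ h0 hκ,
    probReal_compl_eq_one_sub (measurableSet_forall_subtree hE.compl),
    measureReal_forall_subtree χ p hE.compl, probReal_compl_eq_one_sub hE,
    measureReal_rootWeight χ p hp (fun x => measurableSet_lossIn n j (i + x))
      fun x => rootWeightFree_lossIn n j (i + x)]
  rfl

theorem lossProbIn_succ (hp : p.support ⊆ {-1, 0, 1}) (n : ℕ) {i j : ℤ} (h0 : j ≠ 0)
    (hκ : j ≠ κ) : lossProbIn κ χ p (n + 1) i j =
      pgf χ (weightMean p fun x => winProbIn κ χ p n j (i + x)) := by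
  have hE := measurableSet_mem_rootWeight fun x => measurableSet_winIn (κ := κ) n j (i + x)
  rw [lossProbIn, setOf_lossIn_succ h0 hκ, measureReal_forall_subtree χ p hE,
    measureReal_rootWeight χ p hp (fun x => measurableSet_winIn n j (i + x))
      fun x => rootWeightFree_winIn n j (i + x)]
  rfl

end WeightedTreeGame

namespace WeightedTreeGame

/-! ### The offspring generating function -/

open Filter Topology

section pgf

variable (χ : PMF ℕ)

theorem hasSum_pmf_toReal : HasSum (fun m => (χ m).toReal) 1 := by
  have h : ∑' m, (χ m).toReal = 1 := by
    rw [← ENNReal.tsum_toReal_eq χ.apply_ne_top, χ.tsum_coe, ENNReal.toReal_one]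
  rw [← h]
  exact (ENNReal.summable_toReal (by simp [χ.tsum_coe])).hasSum

theorem summable_pgf {x : ℝ} (h0 : 0 ≤ x) (h1 : x ≤ 1) :
    Summable fun m => x ^ m * (χ m).toReal :=
  (hasSum_pmf_toReal χ).summable.of_nonneg_of_le (fun _ => by positivity)
    fun m => mul_le_of_le_one_left ENNReal.toReal_nonneg (pow_le_one₀ h0 h1)

/-- The coefficients are at most 1, so the radius of convergence is at least 1. Analyticity supplies
the continuity of the derivative that is needed when its argument tends to `beta`. -/
theorem analyticOnNhd_pgf : AnalyticOnNhd ℝ (pgf χ) (Metric.eball 0 1) := by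
  set P := FormalMultilinearSeries.ofScalars ℝ (fun m => (χ m).toReal) with hP
  have hr : 1 ≤ P.radius := by
    refine P.le_radius_of_bound (r := 1) 1 fun m => ?_
    rw [hP, FormalMultilinearSeries.ofScalars_norm]
    simp only [NNReal.coe_one, one_pow, mul_one, Real.norm_eq_abs, abs_of_nonneg
      ENNReal.toReal_nonneg]
    exact ENNReal.toReal_mono ENNReal.one_ne_top (χ.coe_le_one m)
  have hsum : P.sum = pgf χ := by
    funext x
    rw [FormalMultilinearSeries.sum, pgf]
    refine tsum_congr fun m => ?_
    rw [hP, FormalMultilinearSeries.ofScalars_apply_eq, smul_eq_mul, mul_comm]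
  rw [← hsum]
  exact (P.hasFPowerSeriesOnBall (by positivity)).analyticOnNhd.mono
    (Metric.eball_subset_eball hr)

theorem analyticAt_pgf {x : ℝ} (h0 : 0 ≤ x) (h1 : x < 1) : AnalyticAt ℝ (pgf χ) x :=
  analyticOnNhd_pgf χ x (by
    rw [← ENNReal.ofReal_one, Metric.eball_ofReal, Metric.mem_ball, Real.dist_0_eq_abs,
      abs_of_nonneg h0]
    exact h1)

theorem pgf_mono {x y : ℝ} (h0 : 0 ≤ x) (hxy : x ≤ y) (h1 : y ≤ 1) : pgf χ x ≤ pgf χ y :=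
  (summable_pgf χ h0 (hxy.trans h1)).tsum_le_tsum
    (fun _ => by gcongr) (summable_pgf χ (h0.trans hxy) h1)

theorem convexOn_pgf : ConvexOn ℝ (Set.Icc 0 1) (pgf χ) := by
  refine ⟨convex_Icc 0 1, fun x hx y hy a b ha hb hab => ?_⟩
  have hz := convex_Icc (0 : ℝ) 1 hx hy ha hb hab
  have hx' := summable_pgf χ hx.1 hx.2
  have hy' := summable_pgf χ hy.1 hy.2
  simp only [pgf, smul_eq_mul] at hz ⊢
  rw [← tsum_mul_left, ← tsum_mul_left, ← (hx'.mul_left a).tsum_add (hy'.mul_left b)]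
  refine (summable_pgf χ hz.1 hz.2).tsum_le_tsum (fun m => ?_)
    ((hx'.mul_left a).add (hy'.mul_left b))
  have := (convexOn_pow m).2 (Set.mem_Ici.2 hx.1) (Set.mem_Ici.2 hy.1) ha hb hab
  simp only [smul_eq_mul] at this
  calc (a * x + b * y) ^ m * (χ m).toReal
      ≤ (a * x ^ m + b * y ^ m) * (χ m).toReal := by gcongr
    _ = _ := by ring

/-- By convexity the slope of a chord is at most the derivative at its right end. -/
theorem pgf_sub_le {x y : ℝ} (h0 : 0 ≤ x) (hxy : x ≤ y) (h1 : y < 1) :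
    pgf χ y - pgf χ x ≤ deriv (pgf χ) y * (y - x) := by
  rcases hxy.eq_or_lt with rfl | hlt
  · simp
  have h := (convexOn_pgf χ).slope_le_deriv ⟨h0, hxy.trans h1.le⟩ ⟨h0.trans hxy, h1.le⟩ hlt
    (analyticAt_pgf χ (h0.trans hxy) h1).differentiableAt
  rwa [slope_def_field, div_le_iff₀ (sub_pos.2 hlt)] at h

theorem deriv_pgf_nonneg {y : ℝ} (h0 : 0 < y) (h1 : y < 1) : 0 ≤ deriv (pgf χ) y := by
  have h := pgf_sub_le χ le_rfl h0.le h1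
  have h' := pgf_mono χ le_rfl h0.le h1.le
  rw [sub_zero] at h
  exact nonneg_of_mul_nonneg_left ((sub_nonneg.2 h').trans h) h0

theorem pgf_pos {x : ℝ} (h0 : 0 < x) (h1 : x ≤ 1) : 0 < pgf χ x := by
  obtain ⟨m, hm⟩ := χ.support_nonempty
  refine (summable_pgf χ h0.le h1).tsum_pos (fun _ => by positivity) m ?_
  have := ENNReal.toReal_pos ((χ.mem_support_iff m).1 hm) (χ.apply_ne_top m)
  positivity

theorem pgf_lt_one (hχ : χ 0 < 1) {x : ℝ} (h0 : 0 ≤ x) (h1 : x < 1) : pgf χ x < 1 := by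
  obtain ⟨m, hm0, hm⟩ : ∃ m, m ≠ 0 ∧ χ m ≠ 0 := by
    by_contra! hcon
    have h := χ.tsum_coe
    rw [tsum_eq_single 0 hcon] at h
    exact hχ.ne h
  have hpos := ENNReal.toReal_pos hm (χ.apply_ne_top m)
  rw [← (hasSum_pmf_toReal χ).tsum_eq]
  refine (summable_pgf χ h0 h1.le).tsum_lt_tsum (i := m)
    (fun n => mul_le_of_le_one_left ENNReal.toReal_nonneg (pow_le_one₀ h0 h1.le)) ?_
    (hasSum_pmf_toReal χ).summable
  exact mul_lt_of_lt_one_left hpos (pow_lt_one₀ h0 h1 hm0)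

end pgf

/-- A nonnegative sequence that eventually contracts every two steps is summable. -/
theorem summable_of_two_step_contraction {A : ℕ → ℝ} (hA : ∀ n, 0 ≤ A n) {c : ℝ} (hc : c < 1)
    (h : ∀ᶠ n in atTop, A (n + 2) ≤ c * A n) : Summable A := by
  obtain ⟨N, hN⟩ := eventually_atTop.1 h
  -- Along indices of a fixed parity the hypothesis becomes an ordinary ratio test.
  have hsub : ∀ r, Summable fun n => A (2 * n + r) := by
    intro r
    refine summable_of_ratio_norm_eventually_le hc (eventually_atTop.2 ⟨N, fun n hn => ?_⟩)
    rw [Real.norm_of_nonneg (hA _), Real.norm_of_nonneg (hA _),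
      show 2 * (n + 1) + r = 2 * n + r + 2 by ring]
    exact hN (2 * n + r) (by omega)
  exact ((hsub 0).hasSum.even_add_odd (hsub 1).hasSum).summable

/-! ### Means with respect to the edge weight -/

section weightMean

variable {p : PMF ℤ}

theorem weightMean_eq (f : ℤ → ℝ) : weightMean p f =
    (p (-1)).toReal * f (-1) + (p 0).toReal * f 0 + (p 1).toReal * f 1 := by
  simp [weightMean, add_assoc]

theorem sum_weights (hp : p.support ⊆ {-1, 0, 1}) :
    (p (-1)).toReal + (p 0).toReal + (p 1).toReal = 1 := by
  have h := p.tsum_coe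
  rw [tsum_eq_sum (s := {-1, 0, 1}) fun x hx => by
    by_contra h
    exact hx (by simpa using hp ((p.mem_support_iff x).2 h))] at h
  have h' := congrArg ENNReal.toReal h
  rw [ENNReal.toReal_sum fun x _ => p.apply_ne_top x] at h'
  simpa [add_assoc] using h'

theorem toReal_weight_eq_zero (hp : p.support ⊆ {-1, 0, 1}) {x : ℤ} (hx : x ∉ Finset.Icc (-1) 1) :
    (p x).toReal = 0 := by
  have : p x = 0 := by
    by_contra h
    have := hp ((p.mem_support_iff x).2 h)
    simp only [Set.mem_insert_iff, Set.mem_singleton_iff] at this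
    rw [Finset.mem_Icc] at hx
    omega
  rw [this, ENNReal.toReal_zero]

theorem weightMean_mono {f g : ℤ → ℝ} (h : ∀ x, f x ≤ g x) : weightMean p f ≤ weightMean p g :=
  Finset.sum_le_sum fun x _ => mul_le_mul_of_nonneg_left (h x) ENNReal.toReal_nonneg

theorem weightMean_nonneg {f : ℤ → ℝ} (h : ∀ x, 0 ≤ f x) : 0 ≤ weightMean p f :=
  Finset.sum_nonneg fun x _ => mul_nonneg ENNReal.toReal_nonneg (h x)

theorem weightMean_sub (f g : ℤ → ℝ) :
    weightMean p (fun x => f x - g x) = weightMean p f - weightMean p g := by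
  simp only [weightMean_eq]
  ring

theorem weightMean_one_sub (hp : p.support ⊆ {-1, 0, 1}) (f : ℤ → ℝ) :
    weightMean p (fun x => 1 - f x) = 1 - weightMean p f := by
  simp only [weightMean_eq]
  linear_combination sum_weights hp

theorem mul_le_weightMean {f : ℤ → ℝ} (h : ∀ x, 0 ≤ f x) {x : ℤ}
    (hx : x ∈ ({-1, 0, 1} : Finset ℤ)) : (p x).toReal * f x ≤ weightMean p f :=
  Finset.single_le_sum (f := fun x => (p x).toReal * f x)
    (fun y _ => mul_nonneg ENNReal.toReal_nonneg (h y)) hx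

theorem weightMean_le_one (hp : p.support ⊆ {-1, 0, 1}) {f : ℤ → ℝ} (h : ∀ x, f x ≤ 1) :
    weightMean p f ≤ 1 := by
  have := weightMean_nonneg (p := p) fun x => sub_nonneg.2 (h x)
  rw [weightMean_one_sub hp] at this
  linarith

theorem tendsto_weightMean {f : ℕ → ℤ → ℝ} {g : ℤ → ℝ}
    (h : ∀ x, Tendsto (fun n => f n x) atTop (𝓝 (g x))) :
    Tendsto (fun n => weightMean p (f n)) atTop (𝓝 (weightMean p g)) :=
  tendsto_finsetSum _ fun x _ => (h x).const_mul _

/-- From an interior capital one edge leads at most to `0` or `κ`, where `f` vanishes, so only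
interior capitals contribute. -/
theorem weightMean_add_eq_sum {κ : ℕ} (hp : p.support ⊆ {-1, 0, 1}) {f : ℤ → ℝ} (h0 : f 0 = 0)
    (hκ : f κ = 0) {i : ℤ} (hi : i ∈ Finset.Icc (1 : ℤ) (κ - 1)) :
    weightMean p (fun x => f (i + x)) =
      ∑ s ∈ Finset.Icc (1 : ℤ) (κ - 1), (p (s - i)).toReal * f s := by
  rw [Finset.mem_Icc] at hi
  have h1 : ∑ s ∈ Finset.Icc (1 : ℤ) (κ - 1), (p (s - i)).toReal * f s =
      ∑ s ∈ Finset.Icc (0 : ℤ) κ, (p (s - i)).toReal * f s := by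
    refine Finset.sum_subset (Finset.Icc_subset_Icc (by omega) (by omega)) fun s hs hs' => ?_
    rw [Finset.mem_Icc] at hs hs'
    obtain rfl | rfl : s = 0 ∨ s = κ := by omega
    · rw [h0, mul_zero]
    · rw [hκ, mul_zero]
  have h2 : ∑ s ∈ Finset.Icc (i - 1) (i + 1), (p (s - i)).toReal * f s =
      ∑ s ∈ Finset.Icc (0 : ℤ) κ, (p (s - i)).toReal * f s := by
    refine Finset.sum_subset (Finset.Icc_subset_Icc (by omega) (by omega)) fun s hs hs' => ?_
    rw [toReal_weight_eq_zero hp, zero_mul]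
    rw [Finset.mem_Icc] at hs' ⊢
    omega
  have h3 : Finset.Icc (i - 1) (i + 1) = {i - 1, i, i + 1} := by
    ext s
    simp only [Finset.mem_Icc, Finset.mem_insert, Finset.mem_singleton]
    omega
  rw [h1, ← h2, h3, Finset.sum_insert (by simp; omega), Finset.sum_insert (by simp),
    Finset.sum_singleton, weightMean_eq, sub_sub_cancel_left, sub_self, add_sub_cancel_left,
    add_zero, ← sub_eq_add_neg, add_assoc]

end weightMean

/-! ### Limits of the probabilities of a bounded win -/

section limits

variable {κ : ℕ} (χ : PMF ℕ) (p : PMF ℤ)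

theorem winProb_eq_measureReal_iUnion {i : ℤ} (hi : i ≠ 0) (hi' : i ≠ κ) (j : ℤ) :
    winProb κ χ p i j = (treeLaw χ p).real (⋃ n, {t | WinIn κ n t i j}) := by
  rw [winProb]
  congr 1
  ext t
  simp [win_iff_exists_winIn hi hi']

theorem lossProb_eq_measureReal_iUnion {i : ℤ} (hi : i ≠ 0) (hi' : i ≠ κ) (j : ℤ) :
    lossProb κ χ p i j = (treeLaw χ p).real (⋃ n, {t | LossIn κ n t i j}) := by
  rw [lossProb]
  congr 1
  ext t
  simp [loss_iff_exists_lossIn hi hi']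

theorem winProbIn_le_winProb {i : ℤ} (hi : i ≠ 0) (hi' : i ≠ κ) (j : ℤ) (n : ℕ) :
    winProbIn κ χ p n i j ≤ winProb κ χ p i j := by
  rw [winProb_eq_measureReal_iUnion χ p hi hi']
  exact measureReal_mono (Set.subset_iUnion (fun n => {t | WinIn κ n t i j}) n)

theorem lossProbIn_le_lossProb {i : ℤ} (hi : i ≠ 0) (hi' : i ≠ κ) (j : ℤ) (n : ℕ) :
    lossProbIn κ χ p n i j ≤ lossProb κ χ p i j := by
  rw [lossProb_eq_measureReal_iUnion χ p hi hi']
  exact measureReal_mono (Set.subset_iUnion (fun n => {t | LossIn κ n t i j}) n)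

theorem tendsto_winProbIn {i : ℤ} (hi : i ≠ 0) (hi' : i ≠ κ) (j : ℤ) :
    Tendsto (fun n => winProbIn κ χ p n i j) atTop (𝓝 (winProb κ χ p i j)) := by
  rw [winProb_eq_measureReal_iUnion χ p hi hi']
  exact (ENNReal.tendsto_toReal (measure_ne_top _ _)).comp
    (tendsto_measure_iUnion_atTop fun m n h t => monotone_winIn t i j h)

theorem tendsto_lossProbIn {i : ℤ} (hi : i ≠ 0) (hi' : i ≠ κ) (j : ℤ) :
    Tendsto (fun n => lossProbIn κ χ p n i j) atTop (𝓝 (lossProb κ χ p i j)) := by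
  rw [lossProb_eq_measureReal_iUnion χ p hi hi']
  exact (ENNReal.tendsto_toReal (measure_ne_top _ _)).comp
    (tendsto_measure_iUnion_atTop fun m n h t => monotone_lossIn t i j h)

theorem winProb_le_one (i j : ℤ) : winProb κ χ p i j ≤ 1 := measureReal_le_one

theorem lossProb_le_one (i j : ℤ) : lossProb κ χ p i j ≤ 1 := measureReal_le_one

theorem winProb_nonneg (i j : ℤ) : 0 ≤ winProb κ χ p i j := measureReal_nonneg

theorem lossProb_nonneg (i j : ℤ) : 0 ≤ lossProb κ χ p i j := measureReal_nonneg

theorem winProbIn_le_one (n : ℕ) (i j : ℤ) : winProbIn κ χ p n i j ≤ 1 := measureReal_le_one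

theorem lossProbIn_le_one (n : ℕ) (i j : ℤ) : lossProbIn κ χ p n i j ≤ 1 := measureReal_le_one

theorem winProbIn_nonneg (n : ℕ) (i j : ℤ) : 0 ≤ winProbIn κ χ p n i j := measureReal_nonneg

theorem lossProbIn_nonneg (n : ℕ) (i j : ℤ) : 0 ≤ lossProbIn κ χ p n i j := measureReal_nonneg

theorem winProbIn_of_zero (n : ℕ) (i : ℤ) : winProbIn κ χ p n i 0 = 1 := by
  simp [winProbIn, winIn_of_eq_zero]

theorem lossProbIn_of_zero (hκ : (κ : ℤ) ≠ 0) (n : ℕ) (i : ℤ) : lossProbIn κ χ p n i 0 = 0 := by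
  have h : ∀ t, ¬ LossIn κ n t i 0 := fun t => winIn_of_eq_zero.not_lossIn hκ
  simp [lossProbIn, h]

theorem winProbIn_of_eq (hκ : (κ : ℤ) ≠ 0) (n : ℕ) (i : ℤ) : winProbIn κ χ p n i κ = 0 := by
  have h : ∀ t, ¬ WinIn κ n t i κ := fun t ht => ht.not_lossIn hκ lossIn_of_eq
  simp [winProbIn, h]

theorem lossProbIn_of_eq (n : ℕ) (i : ℤ) : lossProbIn κ χ p n i κ = 1 := by
  simp [lossProbIn, lossIn_of_eq]

theorem measurableSet_win {i : ℤ} (hi : i ≠ 0) (hi' : i ≠ κ) (j : ℤ) :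
    MeasurableSet {t | Win κ t [] i j} := by
  simp only [win_iff_exists_winIn hi hi', Set.ofPred_exists]
  exact MeasurableSet.iUnion fun n => measurableSet_winIn n i j

theorem measurableSet_loss {i : ℤ} (hi : i ≠ 0) (hi' : i ≠ κ) (j : ℤ) :
    MeasurableSet {t | Loss κ t [] i j} := by
  simp only [loss_iff_exists_lossIn hi hi', Set.ofPred_exists]
  exact MeasurableSet.iUnion fun n => measurableSet_lossIn n i j

theorem winProb_add_lossProb_add_drawProb (hκ : (κ : ℤ) ≠ 0) {i : ℤ} (hi : i ≠ 0) (hi' : i ≠ κ)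
    (j : ℤ) : winProb κ χ p i j + lossProb κ χ p i j + drawProb κ χ p i j = 1 := by
  have hdraw : {t | Draw κ t [] i j} = ({t | Win κ t [] i j} ∪ {t | Loss κ t [] i j})ᶜ := by
    ext t
    simp [Draw]
  rw [winProb, lossProb, drawProb, hdraw, ← measureReal_union _ (measurableSet_loss hi hi' j),
    probReal_add_probReal_compl
      ((measurableSet_win hi hi' j).union (measurableSet_loss hi hi' j))]
  exact Set.disjoint_left.2 fun t hw hl => not_win_and_loss hκ hi hi' ⟨hw, hl⟩

end limits

/-! ### Bounds on the values of the game -/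

section interior

variable {κ : ℕ} {χ : PMF ℕ} {p : PMF ℤ}

theorem ne_zero_of_mem_Icc {i : ℤ} (hi : i ∈ Finset.Icc (1 : ℤ) (κ - 1)) : i ≠ 0 := by
  rw [Finset.mem_Icc] at hi
  omega

theorem ne_of_mem_Icc {i : ℤ} (hi : i ∈ Finset.Icc (1 : ℤ) (κ - 1)) : i ≠ κ := by
  rw [Finset.mem_Icc] at hi
  omega

theorem cast_ne_zero_of_mem_Icc {i : ℤ} (hi : i ∈ Finset.Icc (1 : ℤ) (κ - 1)) :
    (κ : ℤ) ≠ 0 := by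
  rw [Finset.mem_Icc] at hi
  omega

/-- The player with capital `k + 1` can be ruined by meeting only edges of weight `-1` while the
opponent uses edges of weight `0`. Induction on `k` makes this precise, starting from capital `0`.
-/
theorem exists_probIn_pos (hχ : χ 0 < 1) (hp : p.support ⊆ {-1, 0, 1}) (hneg : 0 < p (-1))
    (hzero : 0 < p 0) {i : ℤ} (hi : i ∈ Finset.Icc (1 : ℤ) (κ - 1)) (k : ℕ) :
    (k : ℤ) + 1 ∈ Finset.Icc (1 : ℤ) (κ - 1) →
      (∃ n, 0 < lossProbIn κ χ p n (k + 1) i) ∧ ∃ n, 0 < winProbIn κ χ p n i (k + 1) := by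
  have hneg' := ENNReal.toReal_pos hneg.ne' (p.apply_ne_top _)
  have hzero' := ENNReal.toReal_pos hzero.ne' (p.apply_ne_top _)
  intro hk
  have hloss : ∃ n, 0 < lossProbIn κ χ p n (k + 1) i := by
    obtain ⟨n, hn⟩ : ∃ n, 0 < winProbIn κ χ p n i k := by
      cases k with
      | zero => exact ⟨0, by simp [winProbIn_of_zero]⟩
      | succ k =>
        have := (exists_probIn_pos hχ hp hneg hzero hi k (by
          rw [Finset.mem_Icc] at hk ⊢
          push_cast at hk
          omega)).2
        exact_mod_cast this
    refine ⟨n + 1, ?_⟩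
    rw [lossProbIn_succ χ p hp n (ne_zero_of_mem_Icc hi) (ne_of_mem_Icc hi)]
    refine pgf_pos χ (lt_of_lt_of_le ?_ (mul_le_weightMean
      (f := fun x => winProbIn κ χ p n i (k + 1 + x)) (fun x => winProbIn_nonneg χ p n i _)
      (x := -1) (by simp))) (weightMean_le_one hp fun x => winProbIn_le_one χ p n i _)
    simpa using mul_pos hneg' hn
  refine ⟨hloss, ?_⟩
  obtain ⟨n, hn⟩ := hloss
  refine ⟨n + 1, ?_⟩
  rw [winProbIn_succ χ p hp n (ne_zero_of_mem_Icc hk) (ne_of_mem_Icc hk)]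
  refine sub_pos.2 (pgf_lt_one χ hχ
    (sub_nonneg.2 (weightMean_le_one hp fun x => lossProbIn_le_one χ p n _ _))
    (sub_lt_self _ (lt_of_lt_of_le ?_ (mul_le_weightMean
      (f := fun x => lossProbIn κ χ p n (k + 1) (i + x)) (fun x => lossProbIn_nonneg χ p n _ _)
      (x := 0) (by simp)))))
  simpa using mul_pos hzero' hn

theorem winProb_pos (hχ : χ 0 < 1) (hp : p.support ⊆ {-1, 0, 1}) (hneg : 0 < p (-1))
    (hzero : 0 < p 0) {i j : ℤ} (hi : i ∈ Finset.Icc (1 : ℤ) (κ - 1))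
    (hj : j ∈ Finset.Icc (1 : ℤ) (κ - 1)) : 0 < winProb κ χ p i j := by
  obtain ⟨k, rfl⟩ : ∃ k : ℕ, j = k + 1 := ⟨(j - 1).toNat, by rw [Finset.mem_Icc] at hj; omega⟩
  obtain ⟨n, hn⟩ := (exists_probIn_pos hχ hp hneg hzero hi k hj).2
  exact hn.trans_le (winProbIn_le_winProb χ p (ne_zero_of_mem_Icc hi) (ne_of_mem_Icc hi) _ n)

theorem lossProb_pos (hχ : χ 0 < 1) (hp : p.support ⊆ {-1, 0, 1}) (hneg : 0 < p (-1))
    (hzero : 0 < p 0) {i j : ℤ} (hi : i ∈ Finset.Icc (1 : ℤ) (κ - 1))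
    (hj : j ∈ Finset.Icc (1 : ℤ) (κ - 1)) : 0 < lossProb κ χ p i j := by
  obtain ⟨k, rfl⟩ : ∃ k : ℕ, i = k + 1 := ⟨(i - 1).toNat, by rw [Finset.mem_Icc] at hi; omega⟩
  obtain ⟨n, hn⟩ := (exists_probIn_pos hχ hp hneg hzero hj k hi).1
  exact hn.trans_le (lossProbIn_le_lossProb χ p (ne_zero_of_mem_Icc hi) (ne_of_mem_Icc hi) _ n)

theorem winProb_add_lossProb_le_one {i : ℤ} (hi : i ∈ Finset.Icc (1 : ℤ) (κ - 1)) (j : ℤ) :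
    winProb κ χ p i j + lossProb κ χ p i j ≤ 1 := by
  have h := winProb_add_lossProb_add_drawProb χ p (cast_ne_zero_of_mem_Icc hi)
    (ne_zero_of_mem_Icc hi) (ne_of_mem_Icc hi) j
  have h' : 0 ≤ drawProb κ χ p i j := measureReal_nonneg
  linarith

theorem weightMean_mem_Ioo (hp : p.support ⊆ {-1, 0, 1}) (hzero : 0 < p 0) {f : ℤ → ℝ}
    (h0 : ∀ x, 0 ≤ f x) (h1 : ∀ x, f x ≤ 1) (hf : f 0 ∈ Set.Ioo 0 1) :
    weightMean p f ∈ Set.Ioo 0 1 := by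
  have hzero' := ENNReal.toReal_pos hzero.ne' (p.apply_ne_top _)
  refine ⟨(mul_pos hzero' hf.1).trans_le (mul_le_weightMean h0 (by simp)), ?_⟩
  have h := (mul_pos hzero' (sub_pos.2 hf.2)).trans_le
    (mul_le_weightMean (f := fun x => 1 - f x) (fun x => sub_nonneg.2 (h1 x)) (by simp))
  rw [weightMean_one_sub hp] at h
  linarith

theorem alpha_eq (i j : ℤ) :
    alpha κ χ p i j = weightMean p fun x => winProb κ χ p j (i + x) := by
  simp [alpha, weightMean_eq, sub_eq_add_neg]

theorem beta_eq (hp : p.support ⊆ {-1, 0, 1}) (i j : ℤ) :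
    beta κ χ p i j = 1 - weightMean p fun x => lossProb κ χ p j (i + x) := by
  rw [← weightMean_one_sub hp]
  simp [beta, weightMean_eq, sub_eq_add_neg]

/-- The term of weight `0` already keeps the mean away from both ends: its win probability is
positive, and below 1 because the loss probability is positive. -/
theorem alpha_mem_Ioo (hχ : χ 0 < 1) (hp : p.support ⊆ {-1, 0, 1}) (hneg : 0 < p (-1))
    (hzero : 0 < p 0) {i j : ℤ} (hi : i ∈ Finset.Icc (1 : ℤ) (κ - 1))
    (hj : j ∈ Finset.Icc (1 : ℤ) (κ - 1)) : alpha κ χ p i j ∈ Set.Ioo 0 1 := by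
  rw [alpha_eq]
  refine weightMean_mem_Ioo hp hzero (fun x => winProb_nonneg χ p _ _)
    (fun x => winProb_le_one χ p _ _) ?_
  rw [add_zero]
  have h := lossProb_pos hχ hp hneg hzero hj hi
  have h' := winProb_add_lossProb_le_one (χ := χ) (p := p) hj i
  exact ⟨winProb_pos hχ hp hneg hzero hj hi, by linarith⟩

theorem beta_mem_Ioo (hχ : χ 0 < 1) (hp : p.support ⊆ {-1, 0, 1}) (hneg : 0 < p (-1))
    (hzero : 0 < p 0) {i j : ℤ} (hi : i ∈ Finset.Icc (1 : ℤ) (κ - 1))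
    (hj : j ∈ Finset.Icc (1 : ℤ) (κ - 1)) : beta κ χ p i j ∈ Set.Ioo 0 1 := by
  have hmem : (weightMean p fun x => lossProb κ χ p j (i + x)) ∈ Set.Ioo 0 1 := by
    refine weightMean_mem_Ioo hp hzero (fun x => lossProb_nonneg χ p _ _)
      (fun x => lossProb_le_one χ p _ _) ?_
    rw [add_zero]
    have h := winProb_pos hχ hp hneg hzero hj hi
    have h' := winProb_add_lossProb_le_one (χ := χ) (p := p) hj i
    exact ⟨lossProb_pos hχ hp hneg hzero hj hi, by linarith⟩
  rw [beta_eq hp]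
  exact ⟨sub_pos.2 hmem.2, sub_lt_self _ hmem.1⟩

/-- The probability that the move along a given edge leaves the mover without a forced win of the
remaining game within `n` moves. -/
noncomputable def betaIn (κ : ℕ) (χ : PMF ℕ) (p : PMF ℤ) (n : ℕ) (i j : ℤ) : ℝ :=
  1 - weightMean p fun x => lossProbIn κ χ p n j (i + x)

theorem beta_le_betaIn (hp : p.support ⊆ {-1, 0, 1}) {j : ℤ}
    (hj : j ∈ Finset.Icc (1 : ℤ) (κ - 1)) (n : ℕ) (i : ℤ) :
    beta κ χ p i j ≤ betaIn κ χ p n i j := by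
  rw [beta_eq hp, betaIn]
  exact sub_le_sub_left (weightMean_mono fun x =>
    lossProbIn_le_lossProb χ p (ne_zero_of_mem_Icc hj) (ne_of_mem_Icc hj) _ n) _

theorem tendsto_betaIn (hp : p.support ⊆ {-1, 0, 1}) {j : ℤ}
    (hj : j ∈ Finset.Icc (1 : ℤ) (κ - 1)) (i : ℤ) :
    Tendsto (fun n => betaIn κ χ p n i j) atTop (𝓝 (beta κ χ p i j)) := by
  rw [beta_eq hp]
  exact (tendsto_weightMean fun x =>
    tendsto_lossProbIn χ p (ne_zero_of_mem_Icc hj) (ne_of_mem_Icc hj) _).const_sub 1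

/-- The recursion passes to the limit because `pgf χ` is continuous at the interior point `alpha`.
-/
theorem lossProb_eq_pgf_alpha (hχ : χ 0 < 1) (hp : p.support ⊆ {-1, 0, 1}) (hneg : 0 < p (-1))
    (hzero : 0 < p 0) {i j : ℤ} (hi : i ∈ Finset.Icc (1 : ℤ) (κ - 1))
    (hj : j ∈ Finset.Icc (1 : ℤ) (κ - 1)) : lossProb κ χ p i j = pgf χ (alpha κ χ p i j) := by
  have hα := alpha_mem_Ioo hχ hp hneg hzero hi hj
  have h1 := (tendsto_add_atTop_iff_nat 1).2
    (tendsto_lossProbIn χ p (ne_zero_of_mem_Icc hi) (ne_of_mem_Icc hi) j)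
  simp only [lossProbIn_succ χ p hp _ (ne_zero_of_mem_Icc hj) (ne_of_mem_Icc hj)] at h1
  refine tendsto_nhds_unique h1 ((analyticAt_pgf χ hα.1.le hα.2).continuousAt.tendsto.comp ?_)
  rw [alpha_eq]
  exact tendsto_weightMean fun x =>
    tendsto_winProbIn χ p (ne_zero_of_mem_Icc hj) (ne_of_mem_Icc hj) _

theorem winProb_eq_one_sub_pgf_beta (hχ : χ 0 < 1) (hp : p.support ⊆ {-1, 0, 1}) (hneg : 0 < p (-1))
    (hzero : 0 < p 0) {i j : ℤ} (hi : i ∈ Finset.Icc (1 : ℤ) (κ - 1))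
    (hj : j ∈ Finset.Icc (1 : ℤ) (κ - 1)) :
    winProb κ χ p i j = 1 - pgf χ (beta κ χ p i j) := by
  have hβ := beta_mem_Ioo hχ hp hneg hzero hi hj
  have h1 := (tendsto_add_atTop_iff_nat 1).2
    (tendsto_winProbIn χ p (ne_zero_of_mem_Icc hi) (ne_of_mem_Icc hi) j)
  simp only [winProbIn_succ χ p hp _ (ne_zero_of_mem_Icc hj) (ne_of_mem_Icc hj)] at h1
  exact tendsto_nhds_unique h1 (((analyticAt_pgf χ hβ.1.le hβ.2).continuousAt.tendsto.comp
    (tendsto_betaIn hp hj i)).const_sub 1)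

/-! ### Contraction of the probabilities of a late decision -/

/-- The probability that the first player can force a win, but not within `n` moves. -/
noncomputable def winGap (κ : ℕ) (χ : PMF ℕ) (p : PMF ℤ) (n : ℕ) (i j : ℤ) : ℝ :=
  winProb κ χ p i j - winProbIn κ χ p n i j

/-- The probability that the second player can force a win, but not within `n` moves. -/
noncomputable def lossGap (κ : ℕ) (χ : PMF ℕ) (p : PMF ℤ) (n : ℕ) (i j : ℤ) : ℝ :=
  lossProb κ χ p i j - lossProbIn κ χ p n i j

theorem winGap_nonneg {i : ℤ} (hi : i ∈ Finset.Icc (1 : ℤ) (κ - 1)) (n : ℕ) (j : ℤ) :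
    0 ≤ winGap κ χ p n i j :=
  sub_nonneg.2 (winProbIn_le_winProb χ p (ne_zero_of_mem_Icc hi) (ne_of_mem_Icc hi) j n)

theorem lossGap_nonneg {i : ℤ} (hi : i ∈ Finset.Icc (1 : ℤ) (κ - 1)) (n : ℕ) (j : ℤ) :
    0 ≤ lossGap κ χ p n i j :=
  sub_nonneg.2 (lossProbIn_le_lossProb χ p (ne_zero_of_mem_Icc hi) (ne_of_mem_Icc hi) j n)

/-- Here the game is decided at horizon `0`, so the bounded probabilities are constant and equal to
their limit. The four boundary values are what `weightMean_add_eq_sum` requires. -/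
theorem winGap_of_zero {i : ℤ} (hi : i ∈ Finset.Icc (1 : ℤ) (κ - 1)) (n : ℕ) :
    winGap κ χ p n i 0 = 0 := by
  have h := tendsto_winProbIn χ p (ne_zero_of_mem_Icc hi) (ne_of_mem_Icc hi) 0
  simp only [winProbIn_of_zero] at h
  rw [winGap, winProbIn_of_zero, tendsto_nhds_unique h tendsto_const_nhds, sub_self]

theorem winGap_of_eq {i : ℤ} (hi : i ∈ Finset.Icc (1 : ℤ) (κ - 1)) (n : ℕ) :
    winGap κ χ p n i κ = 0 := by
  have hκ := cast_ne_zero_of_mem_Icc hi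
  have h := tendsto_winProbIn χ p (ne_zero_of_mem_Icc hi) (ne_of_mem_Icc hi) κ
  simp only [winProbIn_of_eq χ p hκ] at h
  rw [winGap, winProbIn_of_eq χ p hκ, tendsto_nhds_unique h tendsto_const_nhds, sub_self]

theorem lossGap_of_zero {i : ℤ} (hi : i ∈ Finset.Icc (1 : ℤ) (κ - 1)) (n : ℕ) :
    lossGap κ χ p n i 0 = 0 := by
  have hκ := cast_ne_zero_of_mem_Icc hi
  have h := tendsto_lossProbIn χ p (ne_zero_of_mem_Icc hi) (ne_of_mem_Icc hi) 0
  simp only [lossProbIn_of_zero χ p hκ] at h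
  rw [lossGap, lossProbIn_of_zero χ p hκ, tendsto_nhds_unique h tendsto_const_nhds, sub_self]

theorem lossGap_of_eq {i : ℤ} (hi : i ∈ Finset.Icc (1 : ℤ) (κ - 1)) (n : ℕ) :
    lossGap κ χ p n i κ = 0 := by
  have h := tendsto_lossProbIn χ p (ne_zero_of_mem_Icc hi) (ne_of_mem_Icc hi) κ
  simp only [lossProbIn_of_eq] at h
  rw [lossGap, lossProbIn_of_eq, tendsto_nhds_unique h tendsto_const_nhds, sub_self]

/-- The limit `alpha` is the larger of the two arguments of `pgf χ`, so the derivative is taken at a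
point independent of `n`. -/
theorem lossGap_succ_le (hχ : χ 0 < 1) (hp : p.support ⊆ {-1, 0, 1}) (hneg : 0 < p (-1))
    (hzero : 0 < p 0) {i j : ℤ} (hi : i ∈ Finset.Icc (1 : ℤ) (κ - 1))
    (hj : j ∈ Finset.Icc (1 : ℤ) (κ - 1)) (n : ℕ) : lossGap κ χ p (n + 1) i j ≤
    deriv (pgf χ) (alpha κ χ p i j) *
      ∑ s ∈ Finset.Icc (1 : ℤ) (κ - 1), (p (s - i)).toReal * winGap κ χ p n j s := by
  have hα := alpha_mem_Ioo hχ hp hneg hzero hi hj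
  rw [← weightMean_add_eq_sum hp (winGap_of_zero hj n) (winGap_of_eq hj n) hi, lossGap,
    lossProb_eq_pgf_alpha hχ hp hneg hzero hi hj,
    lossProbIn_succ χ p hp n (ne_zero_of_mem_Icc hj) (ne_of_mem_Icc hj)]
  simp only [winGap]
  rw [weightMean_sub, ← alpha_eq]
  refine pgf_sub_le χ (weightMean_nonneg fun x => winProbIn_nonneg χ p n _ _) ?_ hα.2
  rw [alpha_eq]
  exact weightMean_mono fun x =>
    winProbIn_le_winProb χ p (ne_zero_of_mem_Icc hj) (ne_of_mem_Icc hj) _ n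

/-- The arguments now decrease with `n`, so the right end of the chord is `betaIn` at horizon `n`
and the derivative still depends on `n`. -/
theorem winGap_succ_le (hχ : χ 0 < 1) (hp : p.support ⊆ {-1, 0, 1}) (hneg : 0 < p (-1))
    (hzero : 0 < p 0) {i j : ℤ} (hi : i ∈ Finset.Icc (1 : ℤ) (κ - 1))
    (hj : j ∈ Finset.Icc (1 : ℤ) (κ - 1)) {n : ℕ} (hβ : betaIn κ χ p n i j < 1) : winGap κ χ p (n + 1) i j ≤
    deriv (pgf χ) (betaIn κ χ p n i j) *
      ∑ s ∈ Finset.Icc (1 : ℤ) (κ - 1), (p (s - i)).toReal * lossGap κ χ p n j s := by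
  have hβ' := beta_mem_Ioo hχ hp hneg hzero hi hj
  have h := pgf_sub_le χ hβ'.1.le (beta_le_betaIn hp hj n i) hβ
  rw [← weightMean_add_eq_sum hp (lossGap_of_zero hj n) (lossGap_of_eq hj n) hi, winGap,
    winProb_eq_one_sub_pgf_beta hχ hp hneg hzero hi hj,
    winProbIn_succ χ p hp n (ne_zero_of_mem_Icc hj) (ne_of_mem_Icc hj)]
  simp only [lossGap]
  rw [weightMean_sub, sub_sub_sub_cancel_left]
  have hd : betaIn κ χ p n i j - beta κ χ p i j =
      (weightMean p fun x => lossProb κ χ p j (i + x)) -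
        weightMean p fun x => lossProbIn κ χ p n j (i + x) := by
    rw [beta_eq hp, betaIn, sub_sub_sub_cancel_left]
  rw [hd] at h
  exact h

/-- The coefficient of the value at `(s, t)` in the bound on the value at `(i, j)` two moves later,
where `b` is the argument of the outer derivative. -/
noncomputable def twoStepCoeff (κ : ℕ) (χ : PMF ℕ) (p : PMF ℤ) (b : ℝ) (i j s t : ℤ) : ℝ :=
  deriv (pgf χ) b * deriv (pgf χ) (alpha κ χ p j s) * (p (s - i)).toReal * (p (t - j)).toReal

theorem winGap_add_two_le (hχ : χ 0 < 1) (hp : p.support ⊆ {-1, 0, 1}) (hneg : 0 < p (-1))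
    (hzero : 0 < p 0) {i j : ℤ} (hi : i ∈ Finset.Icc (1 : ℤ) (κ - 1))
    (hj : j ∈ Finset.Icc (1 : ℤ) (κ - 1)) {n : ℕ} (hβ : betaIn κ χ p (n + 1) i j < 1) :
    winGap κ χ p (n + 2) i j ≤
      ∑ x ∈ Finset.Icc (1 : ℤ) (κ - 1) ×ˢ Finset.Icc (1 : ℤ) (κ - 1),
        twoStepCoeff κ χ p (betaIn κ χ p (n + 1) i j) i j x.1 x.2 * winGap κ χ p n x.1 x.2 := by
  have hβ' := (beta_mem_Ioo hχ hp hneg hzero hi hj).1.trans_le (beta_le_betaIn hp hj (n + 1) i)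
  refine (winGap_succ_le hχ hp hneg hzero hi hj hβ).trans ?_
  rw [Finset.sum_product, Finset.mul_sum]
  refine Finset.sum_le_sum fun s hs => ?_
  refine (mul_le_mul_of_nonneg_left (mul_le_mul_of_nonneg_left
    (lossGap_succ_le hχ hp hneg hzero hj hs n) ENNReal.toReal_nonneg)
    (deriv_pgf_nonneg χ hβ' hβ)).trans_eq ?_
  simp only [Finset.mul_sum, twoStepCoeff]
  exact Finset.sum_congr rfl fun t _ => by ring

/-- The index pairs trade places: `coeff` has the earlier state as its upper index, so summing over
its lower index gives a column sum of the two-step matrix. Its case distinction is automatic, as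
other weights have probability `0`. -/
theorem coeff_eq_twoStepCoeff (hp : p.support ⊆ {-1, 0, 1}) (i j s t : ℤ) :
    coeff κ χ p s t i j = twoStepCoeff κ χ p (beta κ χ p i j) i j s t := by
  rw [coeff, twoStepCoeff]
  split_ifs with h
  · rfl
  · by_cases hs : s - i ∈ Finset.Icc (-1 : ℤ) 1
    · have ht : t - j ∉ Finset.Icc (-1 : ℤ) 1 := by
        rw [Finset.mem_Icc] at hs ⊢
        omega
      rw [toReal_weight_eq_zero hp ht, mul_zero]
    · rw [toReal_weight_eq_zero hp hs, mul_zero, zero_mul]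

theorem summable_sum_winGap (hχ : χ 0 < 1) (hp : p.support ⊆ {-1, 0, 1}) (hneg : 0 < p (-1))
    (hzero : 0 < p 0)
    (hC : ∀ i ∈ Finset.Icc (1 : ℤ) (κ - 1), ∀ j ∈ Finset.Icc (1 : ℤ) (κ - 1),
      ∑ s ∈ Finset.Icc (1 : ℤ) (κ - 1), ∑ t ∈ Finset.Icc (1 : ℤ) (κ - 1),
        coeff κ χ p i j s t < 1) :
    Summable fun n => ∑ x ∈ Finset.Icc (1 : ℤ) (κ - 1) ×ˢ Finset.Icc (1 : ℤ) (κ - 1),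
      winGap κ χ p n x.1 x.2 := by
  set S := Finset.Icc (1 : ℤ) (κ - 1) ×ˢ Finset.Icc (1 : ℤ) (κ - 1) with hS
  have hmem : ∀ x ∈ S, x.1 ∈ Finset.Icc (1 : ℤ) (κ - 1) ∧ x.2 ∈ Finset.Icc (1 : ℤ) (κ - 1) :=
    fun x hx => Finset.mem_product.1 hx
  have hsum : ∀ x ∈ S, ∑ y ∈ S, twoStepCoeff κ χ p (beta κ χ p y.1 y.2) y.1 y.2 x.1 x.2 < 1 := by
    intro x hx
    have h := hC x.1 (hmem x hx).1 x.2 (hmem x hx).2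
    rw [← Finset.sum_product' _ _ fun s t => coeff κ χ p x.1 x.2 s t] at h
    simpa only [coeff_eq_twoStepCoeff hp] using h
  -- Finitely many strict inequalities leave room for one common constant below 1.
  obtain ⟨c, hc, hc1⟩ : ∃ c, (∀ x ∈ S,
      ∑ y ∈ S, twoStepCoeff κ χ p (beta κ χ p y.1 y.2) y.1 y.2 x.1 x.2 < c) ∧ c < 1 := by
    have h1 : ∀ᶠ c in 𝓝[<] (1 : ℝ), ∀ x ∈ S,
        ∑ y ∈ S, twoStepCoeff κ χ p (beta κ χ p y.1 y.2) y.1 y.2 x.1 x.2 < c :=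
      (Finset.eventually_all S).2 fun x hx =>
        mem_of_superset (Ioo_mem_nhdsLT (hsum x hx)) fun c hc => hc.1
    exact (h1.and self_mem_nhdsWithin).exists
  have hβ := fun y (hy : y ∈ S) => beta_mem_Ioo hχ hp hneg hzero (hmem y hy).1 (hmem y hy).2
  have hlim := fun y (hy : y ∈ S) =>
    (tendsto_add_atTop_iff_nat 1).2 (tendsto_betaIn (χ := χ) hp (hmem y hy).2 y.1)
  have hev1 : ∀ᶠ n in atTop, ∀ y ∈ S, betaIn κ χ p (n + 1) y.1 y.2 < 1 :=
    (Finset.eventually_all S).2 fun y hy => (hlim y hy).eventually_lt_const (hβ y hy).2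
  -- The derivative is continuous at `beta`, so the column sums at horizon `n + 1` converge to those
  -- just bounded by `c`.
  have hev2 : ∀ᶠ n in atTop, ∀ x ∈ S,
      ∑ y ∈ S, twoStepCoeff κ χ p (betaIn κ χ p (n + 1) y.1 y.2) y.1 y.2 x.1 x.2 < c := by
    refine (Finset.eventually_all S).2 fun x hx => Tendsto.eventually_lt_const (hc x hx) ?_
    refine tendsto_finsetSum _ fun y hy => ?_
    have hcont := (analyticAt_pgf χ (hβ y hy).1.le (hβ y hy).2).deriv.continuousAt
    exact (((hcont.tendsto.comp (hlim y hy)).mul_const _).mul_const _).mul_const _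
  refine summable_of_two_step_contraction
    (fun n => Finset.sum_nonneg fun x hx => winGap_nonneg (hmem x hx).1 n x.2) hc1 ?_
  filter_upwards [hev1, hev2] with n h1 h2
  calc ∑ y ∈ S, winGap κ χ p (n + 2) y.1 y.2
      ≤ ∑ y ∈ S, ∑ x ∈ S, twoStepCoeff κ χ p (betaIn κ χ p (n + 1) y.1 y.2) y.1 y.2 x.1 x.2 *
          winGap κ χ p n x.1 x.2 := Finset.sum_le_sum fun y hy =>
        winGap_add_two_le hχ hp hneg hzero (hmem y hy).1 (hmem y hy).2 (h1 y hy)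
    _ = ∑ x ∈ S, (∑ y ∈ S,
          twoStepCoeff κ χ p (betaIn κ χ p (n + 1) y.1 y.2) y.1 y.2 x.1 x.2) *
            winGap κ χ p n x.1 x.2 := by
        rw [Finset.sum_comm]
        simp only [Finset.sum_mul]
    _ ≤ ∑ x ∈ S, c * winGap κ χ p n x.1 x.2 := Finset.sum_le_sum fun x hx =>
        mul_le_mul_of_nonneg_right (h2 x hx).le (winGap_nonneg (hmem x hx).1 n x.2)
    _ = c * ∑ x ∈ S, winGap κ χ p n x.1 x.2 := (Finset.mul_sum ..).symm

/-! ### The expected duration -/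

/-- If `N` is the first horizon at which the game is decided, exactly the `N` terms with `n < N`
equal 1. -/
theorem duration_le_tsum_undecided {i : ℤ} (hi : i ∈ Finset.Icc (1 : ℤ) (κ - 1)) (j : ℤ)
    (t : WTree) : (duration κ t [] i j : ℝ≥0∞) ≤
      ∑' n, ({t | WinIn κ n t i j} ∪ {t | LossIn κ n t i j})ᶜ.indicator 1 t := by
  classical
  by_cases hex : ∃ n, WinIn κ n t i j ∨ LossIn κ n t i j
  · have hle : duration κ t [] i j ≤ (Nat.find hex : ℕ∞) := by
      rcases Nat.find_spec hex with h | h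
      · exact duration_le_of_winIn (ne_zero_of_mem_Icc hi) (ne_of_mem_Icc hi) h
      · exact duration_le_of_lossIn (cast_ne_zero_of_mem_Icc hi) (ne_zero_of_mem_Icc hi)
          (ne_of_mem_Icc hi) h
    calc (duration κ t [] i j : ℝ≥0∞) ≤ ((Nat.find hex : ℕ∞) : ℝ≥0∞) := ENat.toENNReal_le.2 hle
      _ = ∑ n ∈ Finset.range (Nat.find hex),
            ({t | WinIn κ n t i j} ∪ {t | LossIn κ n t i j})ᶜ.indicator 1 t := by
          rw [Finset.sum_congr rfl fun n hn =>
            Set.indicator_of_mem (Nat.find_min hex (Finset.mem_range.1 hn)) _]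
          simp
      _ ≤ _ := ENNReal.sum_le_tsum _
  -- With no such horizon every term is 1 and the sum is infinite.
  · push Not at hex
    rw [tsum_congr fun n => Set.indicator_of_mem (s := ({t | WinIn κ n t i j} ∪
      {t | LossIn κ n t i j})ᶜ) (fun h => h.elim (hex n).1 (hex n).2) _]
    simp

/-- Without draws the win and loss probabilities add up to 1, so what is missing at horizon `n` is
exactly the two gaps. -/
theorem measure_undecided {i j : ℤ} (hi : i ∈ Finset.Icc (1 : ℤ) (κ - 1))
    (hdraw : drawProb κ χ p i j = 0) (n : ℕ) :
    treeLaw χ p ({t | WinIn κ n t i j} ∪ {t | LossIn κ n t i j})ᶜ =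
      ENNReal.ofReal (winGap κ χ p n i j + lossGap κ χ p n i j) := by
  have h1 := winProb_add_lossProb_add_drawProb χ p (cast_ne_zero_of_mem_Icc hi)
    (ne_zero_of_mem_Icc hi) (ne_of_mem_Icc hi) j
  have hdisj : Disjoint {t | WinIn κ n t i j} {t | LossIn κ n t i j} :=
    Set.disjoint_left.2 fun t hw hl => hw.not_lossIn (cast_ne_zero_of_mem_Icc hi) hl
  have h2 : (treeLaw χ p).real ({t | WinIn κ n t i j} ∪ {t | LossIn κ n t i j}) =
      winProbIn κ χ p n i j + lossProbIn κ χ p n i j :=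
    measureReal_union hdisj (measurableSet_lossIn n i j)
  rw [← ofReal_measureReal, probReal_compl_eq_one_sub
    ((measurableSet_winIn n i j).union (measurableSet_lossIn n i j)), h2, winGap, lossGap]
  congr 1
  linarith

theorem expectedDuration_lt_top (hχ : χ 0 < 1)
    (hp : p.support ⊆ {-1, 0, 1})
    (hneg : 0 < p (-1)) (hzero : 0 < p 0)
    (hdraw : ∀ i ∈ Finset.Icc (1 : ℤ) (κ - 1), ∀ j ∈ Finset.Icc (1 : ℤ) (κ - 1),
      drawProb κ χ p i j = 0)
    (hC : ∀ i ∈ Finset.Icc (1 : ℤ) (κ - 1), ∀ j ∈ Finset.Icc (1 : ℤ) (κ - 1),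
      ∑ s ∈ Finset.Icc (1 : ℤ) (κ - 1), ∑ t ∈ Finset.Icc (1 : ℤ) (κ - 1),
        coeff κ χ p i j s t < 1) :
    ∀ i ∈ Finset.Icc (1 : ℤ) (κ - 1), ∀ j ∈ Finset.Icc (1 : ℤ) (κ - 1),
      expectedDuration κ χ p i j < ⊤ := by
  have hwin : ∀ i ∈ Finset.Icc (1 : ℤ) (κ - 1), ∀ j ∈ Finset.Icc (1 : ℤ) (κ - 1),
      Summable fun n => winGap κ χ p n i j := by
    intro i hi j hj
    refine (summable_sum_winGap hχ hp hneg hzero hC).of_nonneg_of_le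
      (fun n => winGap_nonneg hi n j) fun n => ?_
    exact Finset.single_le_sum (f := fun x : ℤ × ℤ => winGap κ χ p n x.1 x.2)
      (fun x hx => winGap_nonneg (Finset.mem_product.1 hx).1 n x.2)
      (Finset.mem_product.2 ⟨hi, hj⟩ : (i, j) ∈ _)
  intro i hi j hj
  have hloss : Summable fun n => lossGap κ χ p n i j := by
    -- Loss gaps are controlled by win gaps one step earlier, hence the shift of the index.
    refine (summable_nat_add_iff 1).1 ?_
    refine Summable.of_nonneg_of_le (fun n => lossGap_nonneg hi (n + 1) j)
      (fun n => lossGap_succ_le hχ hp hneg hzero hi hj n) (Summable.mul_left _ ?_)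
    exact summable_sum fun s hs => (hwin j hj s hs).mul_left _
  have hnonneg : ∀ n, 0 ≤ winGap κ χ p n i j + lossGap κ χ p n i j :=
    fun n => add_nonneg (winGap_nonneg hi n j) (lossGap_nonneg hi n j)
  have hmeas : ∀ n, MeasurableSet ({t | WinIn κ n t i j} ∪ {t | LossIn κ n t i j})ᶜ :=
    fun n => ((measurableSet_winIn n i j).union (measurableSet_lossIn n i j)).compl
  calc expectedDuration κ χ p i j
      ≤ ∫⁻ t, ∑' n, ({t | WinIn κ n t i j} ∪ {t | LossIn κ n t i j})ᶜ.indicator 1 t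
          ∂(treeLaw χ p) := lintegral_mono fun t => duration_le_tsum_undecided hi j t
    _ = ∑' n, ENNReal.ofReal (winGap κ χ p n i j + lossGap κ χ p n i j) := by
        rw [lintegral_tsum fun n => (measurable_one.indicator (hmeas n)).aemeasurable]
        exact tsum_congr fun n => by
          rw [lintegral_indicator_one (hmeas n), measure_undecided hi (hdraw i hi j hj)]
    _ = ENNReal.ofReal (∑' n, (winGap κ χ p n i j + lossGap κ χ p n i j)) :=
        (ENNReal.ofReal_tsum_of_nonneg hnonneg ((hwin i hi j hj).add hloss)).symm
    _ < ⊤ := ENNReal.ofReal_lt_top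

end interior

end WeightedTreeGame

theorem theorem3 (κ : ℕ) (χ : PMF ℕ) (hχ : χ 0 < 1)
    (p : PMF ℤ) (hp : p.support ⊆ {-1, 0, 1})
    (hneg : 0 < p (-1)) (hzero : 0 < p 0) (hpos : 0 < p 1)
    (hdraw : ∀ i ∈ Finset.Icc (1 : ℤ) (κ - 1), ∀ j ∈ Finset.Icc (1 : ℤ) (κ - 1),
      WeightedTreeGame.drawProb κ χ p i j = 0)
    (hC : ∀ i ∈ Finset.Icc (1 : ℤ) (κ - 1), ∀ j ∈ Finset.Icc (1 : ℤ) (κ - 1),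
      ∑ s ∈ Finset.Icc (1 : ℤ) (κ - 1), ∑ t ∈ Finset.Icc (1 : ℤ) (κ - 1),
        WeightedTreeGame.coeff κ χ p i j s t < 1) :
    ∀ i ∈ Finset.Icc (1 : ℤ) (κ - 1), ∀ j ∈ Finset.Icc (1 : ℤ) (κ - 1),
      WeightedTreeGame.expectedDuration κ χ p i j < ⊤ := by
  exact WeightedTreeGame.expectedDuration_lt_top hχ hp hneg hzero hdraw hC
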